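/- **Theorem 4.1.** Let $\{\eta_{i,j}\}_{i,j\ge 1}$ be i.i.d. real random variables with $\mathbf E\,\eta_{i,j}=0$ and $\mathbf E\,e^{t_0\eta_{i,j}}<\infty$ for some $t_0>0$. Put $\varphi(t)=\log \mathbf E\,e^{t\eta_{1,1}}\in(-\infty,\infty]$ and $\phi(x)=\sup_{t\ge 0}\{xt-\varphi(t)\}$. Let $\{\lambda_i^{(m)}\}_{i,m\ge1}$ be independent random variables with values in $\{0,1,2,\dots\}$, independent of the family $\{\eta_{i,j}\}$, with law not depending on $i$ and with $\mathbf E\,\lambda_i^{(m)}=m$. Assume that there is a function $\chi:[0,\infty)\to\mathbb R$, differentiable on $(0,\infty)$, such that for every $t\ge 0$ $$\mathbf E\,e^{t\lambda_i^{(m)}}=e^{m\chi(t)(1+o(1))}\qquad (m\to\infty).$$ Put $\psi(s)=\sup_{t\ge0}\{st-\chi(t)\}$ and $$\nu(x)=\inf_{y>0}\left[\psi(y)+y\,\phi\!\left(\frac xy\right)\right]\in[0,\infty],\qquad x\in\mathbb R .$$ Let $\beta>0$, $q>0$, $N=N(m)=\lfloor e^{qm}\rfloor$, $R_{i,m}=\sum_{j=1}^{\lambda_i^{(m)}}\eta_{i,j}$,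 and for real $k$ $$Y^{(k)}_{N,m}(\beta)=\left[\frac1N\sum_{i=1}^N\left(e^{\beta R_{i,m}}\right)^{k/m}\right]^{1/k}.$$ 1. If $k=k(m)$ is a real sequence with $k/m\to\alpha$ as $m\to\infty$, where $\alpha\in[1,\infty)$, then with probability 1 $$\lim_{m\to\infty}\log Y^{(k)}_{N,m}(\beta)=-\inf_{\nu(x)\le q}\left\{\frac{\nu(x)}{\alpha}-\beta x\right\},$$ and this infimum is finite. 2. If $k=k(m)$ is a real sequence with $k/m\to\infty$, then with probability 1 $$\lim_{m\to\infty}\log Y^{(k)}_{N,m}(\beta)=-\inf_{\nu(x)\le q}\{-\beta x\}=\beta\,\nu^{-1}(q),$$ where $\nu^{-1}(q)=\sup\{x:\nu(x)\le q\}$ is finite; if $\nu$ takes a finite value that is at least $q$, then $\nu^{-1}(q)$ is the unique solution $x$ of $\nu(x)=q$. -/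

import Mathlib

open MeasureTheory ProbabilityTheory Filter Topology

namespace RandomProducts

/-- One-sided Cramer transform `sup_{t ≥ 0} (x t - log E exp (t X))` of the law of `X`. The values of
`t` with `E exp (t X) = ∞` contribute `-∞` to the supremum, so only the others are listed. -/
noncomputable def cramer {Ω : Type*} [MeasurableSpace Ω] (μ : Measure Ω) (X : Ω → ℝ) (x : ℝ) :
    EReal :=
  ⨆ t ∈ {t : ℝ | 0 ≤ t ∧ Integrable (fun ω => Real.exp (t * X ω)) μ},
    ((x * t - cgf X μ t : ℝ) : EReal)

/-- One-sided Legendre transform `ψ(s) = sup_{t ≥ 0} (s t - χ(t))`. -/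
noncomputable def legendre (χ : ℝ → ℝ) (s : ℝ) : EReal :=
  ⨆ t ∈ Set.Ici (0 : ℝ), ((s * t - χ t : ℝ) : EReal)

/-- `ν(x) = inf_y (ψ(y) + y φ(x / y))`. The infimum runs over `y > 0`: the expression at `y = 0` is
understood as its limit for `y ↓ 0`, which does not change the infimum. -/
noncomputable def nu (φ ψ : ℝ → EReal) (x : ℝ) : EReal :=
  ⨅ y ∈ Set.Ioi (0 : ℝ), (ψ y + (y : EReal) * φ (x / y))

/-- `R_{i,m} = ∑_{j ≤ λ_i^{(m)}} η_{i,j}` (indices `i`, `j` start at `0`). -/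
def R {Ω : Type*} (η : ℕ → ℕ → Ω → ℝ) (lam : ℕ → ℕ → Ω → ℕ) (i m : ℕ) (ω : Ω) : ℝ :=
  ∑ j ∈ Finset.range (lam i m ω), η i j ω

/-- `Y_{N,m}^{(k)}(β) = [N⁻¹ ∑_{i ≤ N} (exp (β R_{i,m}))^{k/m}]^{1/k}`. -/
noncomputable def Y {Ω : Type*} (η : ℕ → ℕ → Ω → ℝ) (lam : ℕ → ℕ → Ω → ℕ) (β : ℝ) (N m : ℕ) (k : ℝ)
    (ω : Ω) : ℝ :=
  ((1 / (N : ℝ)) * ∑ i ∈ Finset.range N, (Real.exp (β * R η lam i m ω)) ^ (k / (m : ℝ))) ^ (1 / k)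

end RandomProducts

/-! Roughly, `ν` is the exponential rate of `P(R_{i,m} ≥ m x)`, so among `N ≈ e^{qm}` rows about
`e^{m(q - ν(x))}` satisfy `R_{i,m} ≥ m x`. Where `ν(x) > q`, a union bound and Borel–Cantelli leave
eventually no such row. Where `ν(x) < q`, the rows being pairwise independent, Chebyshev and
Borel–Cantelli show that the count is almost surely of its expected size. The average of `e^{β R
k/m}` is then governed by the supremum over `ν(x) ≤ q` of `β x k/m - ν(x)`, on the scale `m`. Taking
the logarithm and dividing by `k` gives the first formula; if `k/m → ∞` the term `ν(x)` becomes
negligible and only the largest `R_{i,m}` matters.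

The rate comes from two matching tail bounds. A minimax argument (`exists_saddle`) turns the infimum
defining `ν` into the Legendre transform of `χ ∘ cgf` (`nu_le_iff`); in this form the upper bound is
Chernoff's inequality (`measureReal_tail_le`), and convexity and closedness of `ν` are immediate.

For the lower bound (`le_measureReal_tail`) the length `λ` is forced to be near `m y₁`, and then the
average of that many summands to be near a level `a'` with `y₁ a' > x'`. The first event is
controlled by a Gärtner–Ellis bound (`exp_le_measureReal_abs_sub_lt`), which needs `y₁` to be a
value of `χ'`; `exists_tilt` supplies it. The second is Cramér's lower bound
(`exp_le_measureReal_sum_ge`), proved by truncation because exponential moments may exist only for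
some exponents.

The counts are converted into bounds on `log Y` by `le_log_Y` and `log_Y_le_of_grid`. -/

namespace RandomProducts

/-! ### Minimax for the two Legendre transforms -/

/-- A one-dimensional minimax theorem: a saddle point `y ≥ 1`. -/
theorem exists_saddle {D : Set ℝ} {c χ : ℝ → ℝ} (hD0 : (0 : ℝ) ∈ D) (hc : ConvexOn ℝ D c)
    (hc0 : c 0 = 0) (hc_nonneg : ∀ t ∈ D, 0 ≤ c t) (hχ : ConvexOn ℝ (Set.Ici 0) χ)
    (hχ_mono : MonotoneOn χ (Set.Ici 0)) (hχ0 : χ 0 = 0) (hχ_le : ∀ t, 0 ≤ t → t ≤ χ t)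
    {x v : ℝ} (h : ∀ t ∈ D, x * t - χ (c t) ≤ v) :
    ∃ y : ℝ, 1 ≤ y ∧ ∀ s, 0 ≤ s → ∀ t ∈ D, y * s - χ s + (x * t - y * c t) ≤ v := by
  -- Pairs with `s < c t` impose lower bounds on `y`, pairs with `s > c t` upper bounds. `A` holds
  -- the lower bounds, with 1 added to keep `y` positive; its supremum works as soon as no lower
  -- bound exceeds an upper one.
  set A : Set ℝ := {r | r = 1 ∨ ∃ s t, 0 ≤ s ∧ t ∈ D ∧ s < c t ∧
    r = (x * t - χ s - v) / (c t - s)} with hA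
  have key : ∀ s₁, 0 ≤ s₁ → ∀ t₁ ∈ D, c t₁ < s₁ → ∀ r ∈ A,
      r ≤ (v + χ s₁ - x * t₁) / (s₁ - c t₁) := by
    intro s₁ hs₁ t₁ ht₁ hlt r hr
    have hd₁ : 0 < s₁ - c t₁ := sub_pos.2 hlt
    rcases hr with rfl | ⟨s₂, t₂, hs₂, ht₂, hlt₂, rfl⟩
    · rw [le_div_iff₀ hd₁]
      have h1 := h t₁ ht₁
      have hct := hc_nonneg t₁ ht₁
      -- `χ s₁ - χ (c t₁) ≥ s₁ - c t₁` by convexity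
      have hs₁pos : 0 < s₁ := lt_of_le_of_lt hct hlt
      have hq1 : 0 ≤ 1 - c t₁ / s₁ := by
        rw [sub_nonneg, div_le_one hs₁pos]; exact hlt.le
      have hq2 : 0 ≤ c t₁ / s₁ := by positivity
      have h2 := hχ.2 (Set.mem_Ici.2 (le_refl (0 : ℝ))) (Set.mem_Ici.2 hs₁) hq1 hq2 (by ring)
      simp only [smul_eq_mul, hχ0, mul_zero, zero_add, div_mul_cancel₀ _ hs₁pos.ne'] at h2
      have h3 := hχ_le s₁ hs₁
      have h4 : χ s₁ - c t₁ / s₁ * χ s₁ ≥ s₁ - c t₁ := by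
        have : χ s₁ - c t₁ / s₁ * χ s₁ = (s₁ - c t₁) * (χ s₁ / s₁) := by
          field_simp
        rw [this]
        have : 1 ≤ χ s₁ / s₁ := by rw [le_div_iff₀ hs₁pos]; linarith
        nlinarith
      linarith
    · have hd₂ : 0 < c t₂ - s₂ := sub_pos.2 hlt₂
      rw [div_le_div_iff₀ hd₂ hd₁]
      -- With weights proportional to `p` and `r` the averages of `c t₁, c t₂` and of `s₁, s₂`
      -- coincide. Hence `c` at the averaged `t` is at most the averaged `s`, and monotonicity and
      -- convexity of `χ` bring in `h`.
      set p := c t₂ - s₂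
      set r := s₁ - c t₁
      have hpr : 0 < p + r := by positivity
      have hab : p / (p + r) + r / (p + r) = 1 := by field_simp
      have hpa : 0 ≤ p / (p + r) := by positivity
      have hra : 0 ≤ r / (p + r) := by positivity
      have hc1 := hc.2 ht₁ ht₂ hpa hra hab
      have htD := hc.1 ht₁ ht₂ hpa hra hab
      have hχ1 := hχ.2 (Set.mem_Ici.2 hs₁) (Set.mem_Ici.2 hs₂) hpa hra hab
      simp only [smul_eq_mul] at hc1 htD hχ1
      have heq : p / (p + r) * c t₁ + r / (p + r) * c t₂
          = p / (p + r) * s₁ + r / (p + r) * s₂ := by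
        field_simp
        simp only [p, r]; ring
      rw [heq] at hc1
      have hm := hχ_mono (Set.mem_Ici.2 (hc_nonneg _ htD))
        (Set.mem_Ici.2 (show 0 ≤ p / (p + r) * s₁ + r / (p + r) * s₂ by positivity)) hc1
      have hf := h _ htD
      have : x * (p / (p + r) * t₁ + r / (p + r) * t₂) - v
          ≤ p / (p + r) * χ s₁ + r / (p + r) * χ s₂ := by linarith
      have h5 := mul_le_mul_of_nonneg_left this hpr.le
      have e1 : (p + r) * (x * (p / (p + r) * t₁ + r / (p + r) * t₂) - v)
          = x * (p * t₁ + r * t₂) - (p + r) * v := by field_simp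
      have e2 : (p + r) * (p / (p + r) * χ s₁ + r / (p + r) * χ s₂) = p * χ s₁ + r * χ s₂ := by
        field_simp
      rw [e1, e2] at h5
      linarith
  have hbdd : BddAbove A := ⟨_, fun r hr => key 1 zero_le_one 0 hD0 (by simp [hc0]) r hr⟩
  refine ⟨sSup A, le_csSup hbdd (Or.inl rfl), fun s hs t ht => ?_⟩
  rcases lt_trichotomy s (c t) with hlt | heq | hgt
  · have := le_csSup hbdd (Or.inr ⟨s, t, hs, ht, hlt, rfl⟩)
    rw [div_le_iff₀ (sub_pos.2 hlt)] at this
    linarith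
  · subst heq
    have := h t ht
    linarith
  · have hne : A.Nonempty := ⟨1, Or.inl rfl⟩
    have := csSup_le hne (key s hs t ht hgt)
    rw [le_div_iff₀ (sub_pos.2 hgt)] at this
    linarith

/-! ### Cumulant generating functions and the dual form of `ν` -/

section Transforms

variable {Ω : Type*} [MeasurableSpace Ω] {μ : Measure Ω} {X : Ω → ℝ}

/-- The nonnegative part of the effective domain of the moment generating function. -/
def expDomain (μ : Measure Ω) (X : Ω → ℝ) : Set ℝ :=
  {t : ℝ | 0 ≤ t ∧ Integrable (fun ω => Real.exp (t * X ω)) μ}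

theorem cramer_le_iff {x v : ℝ} :
    cramer μ X x ≤ v ↔ ∀ t ∈ expDomain μ X, x * t - cgf X μ t ≤ v := by
  simp only [cramer, iSup_le_iff, expDomain, EReal.coe_le_coe_iff]

theorem legendre_le_iff {χ : ℝ → ℝ} {s v : ℝ} :
    legendre χ s ≤ v ↔ ∀ t, 0 ≤ t → s * t - χ t ≤ v := by
  simp only [legendre, iSup_le_iff, Set.mem_Ici, EReal.coe_le_coe_iff]

/-- Hölder's inequality: scale both exponentials to integral one, apply convexity of `exp` pointwise
and integrate. This covers boundary points of the integrability set, where analyticity is not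
available. -/
theorem convexOn_cgf [IsProbabilityMeasure μ] :
    ConvexOn ℝ (integrableExpSet X μ) (cgf X μ) := by
  refine ⟨convex_integrableExpSet, fun a ha b hb p r hp hr hpr => ?_⟩
  have hm := convex_integrableExpSet ha hb hp hr hpr
  simp only [smul_eq_mul] at hm ⊢
  set A := cgf X μ a
  set B := cgf X μ b
  have hA : ∫ ω, Real.exp (a * X ω) ∂μ = Real.exp A := (exp_cgf ha).symm
  have hB : ∫ ω, Real.exp (b * X ω) ∂μ = Real.exp B := (exp_cgf hb).symm
  have hI : ∫ ω, Real.exp ((p * a + r * b) * X ω) ∂μ ≤ ∫ ω, Real.exp (p * A + r * B) *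
      (p * (Real.exp (-A) * Real.exp (a * X ω)) + r * (Real.exp (-B) * Real.exp (b * X ω))) ∂μ := by
    refine integral_mono hm ?_ fun ω => ?_
    · exact (((Integrable.const_mul ha _).const_mul _).add
        ((Integrable.const_mul hb _).const_mul _)).const_mul _
    · have h1 := convexOn_exp.2 (Set.mem_univ (a * X ω - A)) (Set.mem_univ (b * X ω - B)) hp hr hpr
      simp only [smul_eq_mul] at h1
      have h2 : Real.exp ((p * a + r * b) * X ω)
          = Real.exp (p * A + r * B) * Real.exp (p * (a * X ω - A) + r * (b * X ω - B)) := by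
        rw [← Real.exp_add]; congr 1; ring
      simp only
      rw [h2, ← Real.exp_add (-A), ← Real.exp_add (-B)]
      refine mul_le_mul_of_nonneg_left ?_ (Real.exp_pos _).le
      convert h1 using 4 <;> ring
  rw [integral_const_mul, integral_add ((Integrable.const_mul ha _).const_mul _)
    ((Integrable.const_mul hb _).const_mul _), integral_const_mul, integral_const_mul,
    integral_const_mul, integral_const_mul, hA, hB, ← Real.exp_add, ← Real.exp_add] at hI
  simp only [neg_add_cancel, Real.exp_zero, mul_one, hpr] at hI
  exact (Real.log_le_iff_le_exp (mgf_pos hm)).2 hI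

theorem expDomain_subset : expDomain μ X ⊆ integrableExpSet X μ := fun _ h => h.2

theorem convexOn_cgf_expDomain [IsProbabilityMeasure μ] :
    ConvexOn ℝ (expDomain μ X) (cgf X μ) :=
  convexOn_cgf.subset expDomain_subset
    ((convex_Ici (0 : ℝ)).inter (convex_integrableExpSet (X := X) (μ := μ)))

theorem zero_mem_expDomain [IsProbabilityMeasure μ] : (0 : ℝ) ∈ expDomain μ X := by
  simp [expDomain]

/-- Jensen's inequality for the cumulant generating function. -/
theorem mul_integral_le_cgf [IsProbabilityMeasure μ] (hX : Integrable X μ) {t : ℝ}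
    (ht : Integrable (fun ω => Real.exp (t * X ω)) μ) : t * ∫ ω, X ω ∂μ ≤ cgf X μ t := by
  set c := t * ∫ ω, X ω ∂μ with hc
  rw [cgf, Real.le_log_iff_exp_le (mgf_pos ht)]
  have hI : ∫ ω, Real.exp c * (1 + (t * X ω - c)) ∂μ ≤ ∫ ω, Real.exp (t * X ω) ∂μ := by
    refine integral_mono ?_ ht fun ω => ?_
    · exact ((integrable_const _).add ((hX.const_mul t).sub (integrable_const _))).const_mul _
    · have h1 := Real.add_one_le_exp (t * X ω - c)
      calc Real.exp c * (1 + (t * X ω - c)) ≤ Real.exp c * Real.exp (t * X ω - c) := by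
            refine mul_le_mul_of_nonneg_left ?_ (Real.exp_pos _).le
            linarith
        _ = Real.exp (t * X ω) := by rw [← Real.exp_add]; congr 1; ring
  have hX' := hX.const_mul t
  have hs : Integrable (fun ω => t * X ω - c) μ := hX'.sub (integrable_const _)
  rw [integral_const_mul, integral_add (integrable_const _) hs, integral_sub hX'
    (integrable_const _), integral_const_mul] at hI
  simp only [integral_const, probReal_univ, smul_eq_mul, one_mul, ← hc, sub_self, add_zero,
    mul_one] at hI
  exact hI

/-- The function `ν` is the Legendre transform of the composition `χ ∘ cgf`. -/
theorem nu_le_iff [IsProbabilityMeasure μ] {χ : ℝ → ℝ} (hc_nonneg : ∀ t ∈ expDomain μ X, 0 ≤ cgf X μ t)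
    (hχ : ConvexOn ℝ (Set.Ici 0) χ) (hχ_mono : MonotoneOn χ (Set.Ici 0)) (hχ0 : χ 0 = 0)
    (hχ_le : ∀ t, 0 ≤ t → t ≤ χ t) {x v : ℝ} :
    nu (cramer μ X) (legendre χ) x ≤ v ↔
      ∀ t ∈ expDomain μ X, x * t - χ (cgf X μ t) ≤ v := by
  constructor
  · intro h t ht
    rw [← EReal.coe_le_coe_iff]
    refine le_trans (le_iInf₂ fun y hy => ?_) h
    have hy' : (0 : ℝ) < y := hy
    -- Testing `ψ` at `s = cgf X μ t` makes the two terms `y * cgf X μ t` cancel.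
    have h1 : ((y * cgf X μ t - χ (cgf X μ t) : ℝ) : EReal) ≤ legendre χ y :=
      le_iSup₂_of_le (f := fun t (_ : t ∈ Set.Ici (0 : ℝ)) => ((y * t - χ t : ℝ) : EReal))
        (cgf X μ t) (hc_nonneg t ht) le_rfl
    have h2 : ((x / y * t - cgf X μ t : ℝ) : EReal) ≤ cramer μ X (x / y) :=
      le_iSup₂_of_le (f := fun t (_ : t ∈ {t : ℝ | 0 ≤ t ∧
        Integrable (fun ω => Real.exp (t * X ω)) μ}) => ((x / y * t - cgf X μ t : ℝ) : EReal))
        t ht le_rfl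
    have h3 : ((y * (x / y * t - cgf X μ t) : ℝ) : EReal) ≤ (y : EReal) * cramer μ X (x / y) := by
      rw [EReal.coe_mul]
      exact mul_le_mul_of_nonneg_left h2 (EReal.coe_nonneg.2 hy'.le)
    refine le_trans (le_of_eq ?_) (add_le_add h1 h3)
    rw [← EReal.coe_add]
    congr 1
    field_simp
    ring
  · intro h
    obtain ⟨y, hy, hyv⟩ := exists_saddle zero_mem_expDomain convexOn_cgf_expDomain cgf_zero
      hc_nonneg hχ hχ_mono hχ0 hχ_le h
    have hy0 : 0 < y := by linarith
    refine iInf₂_le_of_le y hy0 ?_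
    -- Together with the test value `s = 0`, this shows that `ψ y` is finite, so it can be moved
    -- across inequalities as a real number.
    have hψ : ∀ t ∈ expDomain μ X, legendre χ y ≤ ((v - (x * t - y * cgf X μ t) : ℝ) : EReal) :=
      fun t ht => legendre_le_iff.2 fun s hs => by linarith [hyv s hs t ht]
    have hψ0 : ((0 : ℝ) : EReal) ≤ legendre χ y :=
      le_iSup₂_of_le (f := fun t (_ : t ∈ Set.Ici (0 : ℝ)) => ((y * t - χ t : ℝ) : EReal))
        0 (Set.mem_Ici.2 le_rfl) (by simp [hχ0])
    have hψc : ((legendre χ y).toReal : EReal) = legendre χ y :=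
      EReal.coe_toReal (ne_top_of_le_ne_top (EReal.coe_ne_top _) (hψ 0 zero_mem_expDomain))
        (ne_bot_of_le_ne_bot (EReal.coe_ne_bot _) hψ0)
    set a := (legendre χ y).toReal
    have hφ : cramer μ X (x / y) ≤ (((v - a) / y : ℝ) : EReal) := by
      refine cramer_le_iff.2 fun t ht => ?_
      have := hψ t ht
      rw [← hψc, EReal.coe_le_coe_iff] at this
      rw [le_div_iff₀ hy0]
      have e : (x / y * t - cgf X μ t) * y = x * t - y * cgf X μ t := by field_simp
      linarith
    calc legendre χ y + y * cramer μ X (x / y)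
        ≤ (a : EReal) + y * (((v - a) / y : ℝ) : EReal) := by
          rw [← hψc]
          exact add_le_add le_rfl (mul_le_mul_of_nonneg_left hφ (EReal.coe_nonneg.2 hy0.le))
      _ = v := by
          rw [← EReal.coe_mul, ← EReal.coe_add]
          congr 1
          field_simp
          ring

end Transforms

/-! ### Gärtner–Ellis lower bound -/

section LocalLargeDeviations

variable {Ω : Type*} [MeasurableSpace Ω] {μ : Measure Ω} [IsProbabilityMeasure μ]

theorem exp_le_mgf_le_of_tendsto {Z : ℕ → Ω → ℝ} {t l : ℝ}
    (hint : ∀ᶠ n in atTop, Integrable (fun ω => Real.exp (t * Z n ω)) μ)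
    (hlim : Tendsto (fun n : ℕ => cgf (Z n) μ t / n) atTop (𝓝 l)) {ε : ℝ} (hε : 0 < ε) :
    ∀ᶠ n : ℕ in atTop, Real.exp (n * (l - ε)) ≤ mgf (Z n) μ t ∧
      mgf (Z n) μ t ≤ Real.exp (n * (l + ε)) := by
  filter_upwards [hint, hlim.eventually (Icc_mem_nhds (sub_lt_self l hε) (lt_add_of_pos_right l hε)),
    eventually_gt_atTop 0] with n h1 h2 h3
  have hn : (0 : ℝ) < n := by exact_mod_cast h3
  rw [← exp_cgf h1, Real.exp_le_exp, Real.exp_le_exp]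
  rw [le_div_iff₀ hn, div_le_iff₀ hn] at h2
  constructor <;> linarith

/-- Local lower bound of Gärtner–Ellis type at a point where the limiting cumulant generating
function is differentiable. -/
theorem exp_le_measureReal_abs_sub_lt {Z : ℕ → Ω → ℝ} (hZ : ∀ n, Measurable (Z n)) {Λ : ℝ → ℝ}
    {t₀ a : ℝ} (hΛ : HasDerivAt Λ a t₀)
    (hint : ∀ᶠ t in 𝓝 t₀, ∀ᶠ n in atTop, Integrable (fun ω => Real.exp (t * Z n ω)) μ)
    (hlim : ∀ᶠ t in 𝓝 t₀, Tendsto (fun n : ℕ => cgf (Z n) μ t / n) atTop (𝓝 (Λ t)))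
    {δ ε : ℝ} (hδ : 0 < δ) (hε : 0 < ε) :
    ∀ᶠ n : ℕ in atTop, Real.exp (-(n * (t₀ * a - Λ t₀ + ε))) ≤
      μ.real {ω | |Z n ω - n * a| < n * δ} := by
  -- A smaller window only lowers the probability. On a narrow one `t₀ * Z n` varies by at most `n ε
  -- / 4` around `n t₀ a`.
  wlog hδs : |t₀| * δ ≤ ε / 4 generalizing δ
  · set δ' := min δ (ε / (4 * (|t₀| + 1)))
    have hpos : 0 < 4 * (|t₀| + 1) := by positivity
    have hδ' : 0 < δ' := lt_min hδ (by positivity)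
    have hs : |t₀| * δ' ≤ ε / 4 := by
      calc |t₀| * δ' ≤ (|t₀| + 1) * (ε / (4 * (|t₀| + 1))) :=
            mul_le_mul (by linarith) (min_le_right _ _) hδ'.le (by positivity)
        _ = ε / 4 := by field_simp
    filter_upwards [this hδ' hs] with n hn
    refine hn.trans (measureReal_mono fun ω hω => ?_)
    have hω' : |Z n ω - n * a| < n * δ' := hω
    exact lt_of_lt_of_le hω' (mul_le_mul_of_nonneg_left (min_le_left _ _) (Nat.cast_nonneg n))
  -- choose the step `h`
  have hlo := (hasDerivAt_iff_isLittleO_nhds_zero.1 hΛ).def (show 0 < δ / 2 by positivity)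
  have hall := hlo.and (((continuous_const_add t₀).tendsto' 0 t₀ (add_zero t₀)).eventually
    (hint.and hlim))
  obtain ⟨r, hr, hball⟩ := Metric.eventually_nhds_iff.1 hall
  have hh : 0 < r / 2 := by positivity
  set h := r / 2 with hh_def
  have hp := hball (y := h) (by rw [Real.dist_eq, sub_zero, abs_of_pos hh]; linarith)
  have hm := hball (y := -h) (by rw [Real.dist_eq, sub_zero, abs_neg, abs_of_pos hh]; linarith)
  have h0 := hball (y := 0) (by simpa using hr)
  simp only [smul_eq_mul, Real.norm_eq_abs, abs_neg, abs_of_pos hh, add_zero] at hp hm h0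
  obtain ⟨hp1, hp2, hp3⟩ := hp
  obtain ⟨hm1, hm2, hm3⟩ := hm
  obtain ⟨-, h02, h03⟩ := h0
  have hp1' := (abs_le.1 hp1).2
  have hm1' := (abs_le.1 hm1).2
  -- Shifting the exponent by `±h` gains `h δ` outside the window and loses at most `h δ / 2` by
  -- differentiability. The errors `2κ ≤ h δ / 4` leave `h δ / 4`, which absorbs the factor 4.
  set κ := min (h * δ / 8) (ε / 4) with hκ
  have hκ1 : κ ≤ h * δ / 8 := min_le_left _ _
  have hκ2 : κ ≤ ε / 4 := min_le_right _ _
  have hκ0 : 0 < κ := lt_min (by positivity) (by positivity)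
  have hsmall : ∀ᶠ n : ℕ in atTop, Real.log 4 ≤ n * (h * δ / 4) :=
    (tendsto_natCast_atTop_atTop.atTop_mul_const (by positivity)).eventually_ge_atTop _
  have hsmall2 : ∀ᶠ n : ℕ in atTop, Real.log 2 ≤ n * (ε / 4) :=
    (tendsto_natCast_atTop_atTop.atTop_mul_const (by positivity)).eventually_ge_atTop _
  filter_upwards [hp2, hm2, h02, exp_le_mgf_le_of_tendsto hp2 hp3 hκ0,
    exp_le_mgf_le_of_tendsto hm2 hm3 hκ0, exp_le_mgf_le_of_tendsto h02 h03 hκ0, hsmall, hsmall2]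
    with n ip im i0 bp bm b0 hs hs2
  set W : Set Ω := {ω | |Z n ω - n * a| < n * δ} with hW
  have hWm : MeasurableSet W :=
    measurableSet_lt (((hZ n).sub_const _).abs) measurable_const
  have hn0 : (0 : ℝ) ≤ n := Nat.cast_nonneg n
  -- Off the window, one of the exponentials tilted by `±h` dominates, according to the side.
  have hpt : ∀ ω, Real.exp (t₀ * Z n ω) ≤
      W.indicator (fun _ => Real.exp (n * (t₀ * a + ε / 4))) ω +
      (Real.exp (-(h * n * (a + δ))) * Real.exp ((t₀ + h) * Z n ω) +
        Real.exp (h * n * (a - δ)) * Real.exp ((t₀ + -h) * Z n ω)) := by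
    intro ω
    by_cases hω : ω ∈ W
    · rw [Set.indicator_of_mem hω]
      have : t₀ * Z n ω ≤ n * (t₀ * a + ε / 4) := by
        have h1 : t₀ * (Z n ω - n * a) ≤ |t₀| * (n * δ) :=
          (le_abs_self _).trans (by
            rw [abs_mul]; exact mul_le_mul_of_nonneg_left (le_of_lt hω) (abs_nonneg _))
        have h2 := mul_le_mul_of_nonneg_left hδs hn0
        linarith
      have := Real.exp_le_exp.2 this
      have h1 : 0 ≤ Real.exp (-(h * n * (a + δ))) * Real.exp ((t₀ + h) * Z n ω) +
        Real.exp (h * n * (a - δ)) * Real.exp ((t₀ + -h) * Z n ω) := by positivity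
      linarith
    · rw [Set.indicator_of_notMem hω, zero_add, ← Real.exp_add, ← Real.exp_add]
      have hω' : n * δ ≤ |Z n ω - n * a| := not_lt.1 hω
      rcases le_abs.1 hω' with h1 | h1
      · have : Real.exp (t₀ * Z n ω) ≤ Real.exp (-(h * n * (a + δ)) + (t₀ + h) * Z n ω) := by
          rw [Real.exp_le_exp]
          have := mul_le_mul_of_nonneg_left h1 hh.le
          linarith
        have h2 := Real.exp_pos (h * n * (a - δ) + (t₀ + -h) * Z n ω)
        linarith
      · have : Real.exp (t₀ * Z n ω) ≤ Real.exp (h * n * (a - δ) + (t₀ + -h) * Z n ω) := by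
          rw [Real.exp_le_exp]
          have := mul_le_mul_of_nonneg_left h1 hh.le
          linarith
        have h2 := Real.exp_pos (-(h * n * (a + δ)) + (t₀ + h) * Z n ω)
        linarith
  have hind : Integrable (W.indicator fun _ : Ω => Real.exp (n * (t₀ * a + ε / 4))) μ :=
    (integrable_const _).indicator hWm
  have hrest : Integrable (fun ω => Real.exp (-(h * n * (a + δ))) * Real.exp ((t₀ + h) * Z n ω) +
      Real.exp (h * n * (a - δ)) * Real.exp ((t₀ + -h) * Z n ω)) μ :=
    (ip.const_mul _).add (im.const_mul _)
  have hI := integral_mono i0 (hind.add hrest) hpt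
  rw [integral_add' hind hrest, integral_indicator_const _ hWm, integral_add (ip.const_mul _) (im.const_mul _), integral_const_mul, integral_const_mul,
    smul_eq_mul] at hI
  change mgf (Z n) μ t₀ ≤ _ + (_ * mgf (Z n) μ (t₀ + h) + _ * mgf (Z n) μ (t₀ + -h)) at hI
  -- the two tails carry at most half of the mass
  set E := Real.exp (n * (Λ t₀ - κ)) with hE
  have tail : ∀ u w : ℝ, u + n * (w + κ) ≤ n * (Λ t₀ - κ) - n * (h * δ / 4) → ∀ M : ℝ,
      M ≤ Real.exp (n * (w + κ)) → Real.exp u * M ≤ E / 4 := by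
    intro u w huw M hM
    calc Real.exp u * M ≤ Real.exp u * Real.exp (n * (w + κ)) :=
          mul_le_mul_of_nonneg_left hM (Real.exp_pos _).le
      _ = Real.exp (u + n * (w + κ)) := (Real.exp_add _ _).symm
      _ ≤ Real.exp (n * (Λ t₀ - κ) - Real.log 4) := Real.exp_le_exp.2 (by linarith)
      _ = E / 4 := by rw [Real.exp_sub, Real.exp_log (by norm_num)]
  have t1 := tail (-(h * n * (a + δ))) (Λ (t₀ + h)) (by
    have := mul_le_mul_of_nonneg_left
      (show Λ (t₀ + h) + κ - h * a - h * δ ≤ Λ t₀ - κ - h * δ / 4 by nlinarith) hn0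
    linarith) _ bp.2
  have t2 := tail (h * n * (a - δ)) (Λ (t₀ + -h)) (by
    have := mul_le_mul_of_nonneg_left
      (show Λ (t₀ + -h) + κ + h * a - h * δ ≤ Λ t₀ - κ - h * δ / 4 by nlinarith) hn0
    linarith) _ bm.2
  have hfin : E / 2 ≤ μ.real W * Real.exp (n * (t₀ * a + ε / 4)) := by linarith [b0.1]
  have hE2 : Real.exp (n * (Λ t₀ - κ) - n * (ε / 4)) ≤ E / 2 := by
    calc _ ≤ Real.exp (n * (Λ t₀ - κ) - Real.log 2) := Real.exp_le_exp.2 (by linarith)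
      _ = E / 2 := by rw [Real.exp_sub, Real.exp_log (by norm_num)]
  have := hE2.trans hfin
  rw [← div_le_iff₀ (Real.exp_pos _), ← Real.exp_sub] at this
  refine le_trans (Real.exp_le_exp.2 ?_) this
  have := mul_le_mul_of_nonneg_left hκ2 hn0
  linarith [mul_nonneg hn0 hε.le]

end LocalLargeDeviations

/-! ### Cramér's lower bound by truncation -/

section CramerLowerBound

variable {Ω : Type*} [MeasurableSpace Ω] {μ : Measure Ω} [IsProbabilityMeasure μ]

theorem tendsto_mul_exp_div_sub_one (u : ℝ) :
    Tendsto (fun n : ℕ => ((n : ℝ) + 1) * (Real.exp (u / ((n : ℝ) + 1)) - 1)) atTop (𝓝 u) := by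
  have h : HasDerivAt (fun t : ℝ => Real.exp (t * u)) u 0 := by
    have := ((hasDerivAt_id (0 : ℝ)).mul_const u).exp
    simpa using this
  have h1 := h.tendsto_slope_zero
  have h2 : Tendsto (fun n : ℕ => 1 / ((n : ℝ) + 1)) atTop (𝓝[≠] 0) :=
    tendsto_nhdsWithin_iff.2 ⟨tendsto_one_div_add_atTop_nhds_zero_nat,
      Eventually.of_forall fun n => by
        simp only [Set.mem_compl_iff, Set.mem_singleton_iff]; positivity⟩
  refine (h1.comp h2).congr fun n => ?_
  simp only [Function.comp_apply, smul_eq_mul, zero_add, zero_mul, Real.exp_zero, one_div, inv_inv]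
  congr 3
  ring

/-- A random variable with all exponential moments and mean less than `a` satisfies
`E exp (t Y) < exp (t a)` for some `t > 0`. -/
theorem exists_pos_cgf_lt {Y : Ω → ℝ} (hY : Integrable Y μ)
    (hexp : ∀ t, 0 ≤ t → Integrable (fun ω => Real.exp (t * Y ω)) μ) {a : ℝ}
    (ha : ∫ ω, Y ω ∂μ < a) : ∃ t, 0 < t ∧ cgf Y μ t < t * a := by
  by_contra! hcon
  refine ha.not_ge ?_
  -- Domination for the difference quotients at 0: from below by `1 + u ≤ exp u`, from above by
  -- Bernoulli's inequality. Only exponents `t ≥ 0` enter.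
  have hbound : ∀ (n : ℕ) (u : ℝ),
      |((n : ℝ) + 1) * (Real.exp (u / ((n : ℝ) + 1)) - 1)| ≤ |u| + Real.exp u := by
    intro n u
    have hn : (0 : ℝ) < (n : ℝ) + 1 := by positivity
    rw [abs_le]
    constructor
    · have h1 := Real.add_one_le_exp (u / ((n : ℝ) + 1))
      have h2 : u ≤ ((n : ℝ) + 1) * (Real.exp (u / ((n : ℝ) + 1)) - 1) := by
        calc u = ((n : ℝ) + 1) * (u / ((n : ℝ) + 1)) := by field_simp
          _ ≤ _ := mul_le_mul_of_nonneg_left (by linarith) hn.le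
      linarith [neg_abs_le u, Real.exp_pos u]
    · have h1 := one_add_mul_le_pow (a := Real.exp (u / ((n : ℝ) + 1)) - 1)
        (by linarith [Real.exp_pos (u / ((n : ℝ) + 1))]) (n + 1)
      rw [add_sub_cancel, ← Real.exp_nat_mul] at h1
      push_cast at h1
      rw [mul_div_cancel₀ _ hn.ne'] at h1
      linarith [abs_nonneg u]
  have hlim := tendsto_integral_of_dominated_convergence (μ := μ)
    (F := fun (n : ℕ) ω => ((n : ℝ) + 1) * (Real.exp (Y ω / ((n : ℝ) + 1)) - 1)) (f := Y)
    (fun ω => |Y ω| + Real.exp (Y ω))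
    (fun n => by
      have := hY.aestronglyMeasurable.aemeasurable
      exact AEMeasurable.aestronglyMeasurable (by fun_prop))
    (hY.abs.add (by simpa using hexp 1 zero_le_one))
    (fun n => Eventually.of_forall fun ω => hbound n (Y ω))
    (Eventually.of_forall fun ω => tendsto_mul_exp_div_sub_one (Y ω))
  refine ge_of_tendsto' hlim fun n => ?_
  have hn : (0 : ℝ) < (n : ℝ) + 1 := by positivity
  have ht : (0 : ℝ) < 1 / ((n : ℝ) + 1) := by positivity
  have h1 := hcon _ ht
  have h2 := Real.exp_le_exp.2 h1
  rw [exp_cgf (hexp _ ht.le)] at h2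
  have h3 := Real.add_one_le_exp (1 / ((n : ℝ) + 1) * a)
  have hi : Integrable (fun ω => Real.exp (Y ω / ((n : ℝ) + 1))) μ := by
    refine (hexp _ ht.le).congr (Eventually.of_forall fun ω => ?_)
    simp only; congr 1; ring
  rw [integral_const_mul, integral_sub hi (integrable_const _)]
  have h4 : ∫ ω, Real.exp (Y ω / ((n : ℝ) + 1)) ∂μ = mgf Y μ (1 / ((n : ℝ) + 1)) := by
    rw [mgf]; congr 1; ext ω; congr 1; ring
  rw [h4]
  simp only [integral_const, probReal_univ, smul_eq_mul, mul_one]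
  calc a = ((n : ℝ) + 1) * (1 / ((n : ℝ) + 1) * a) := by field_simp
    _ ≤ _ := mul_le_mul_of_nonneg_left (by linarith) hn.le

theorem le_cgf_of_measureReal_pos {Y : Ω → ℝ} {t b : ℝ} (ht : 0 ≤ t)
    (hexp : Integrable (fun ω => Real.exp (t * Y ω)) μ) (hp : 0 < μ.real {ω | b ≤ Y ω}) :
    t * b + Real.log (μ.real {ω | b ≤ Y ω}) ≤ cgf Y μ t := by
  have h := measure_ge_le_exp_cgf b ht hexp
  have := Real.log_le_log hp h
  rw [Real.log_exp] at this
  linarith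

theorem integrable_exp_mul_min {X : Ω → ℝ} (hX : Measurable X) (M : ℝ) {t : ℝ} (ht : 0 ≤ t) :
    Integrable (fun ω => Real.exp (t * min (X ω) M)) μ :=
  integrable_exp_mul_of_le t M ht (hX.min measurable_const).aemeasurable
    (Eventually.of_forall fun _ => min_le_right _ _)

/-- The derivative of the cumulant generating function takes every value between the mean and the
essential supremum. -/
theorem exists_hasDerivAt_cgf {Y : Ω → ℝ} (hY : Integrable Y μ)
    (hexp : ∀ t, 0 ≤ t → Integrable (fun ω => Real.exp (t * Y ω)) μ) {a b : ℝ}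
    (ha : ∫ ω, Y ω ∂μ < a) (hab : a < b) (hp : 0 < μ.real {ω | b ≤ Y ω}) :
    ∃ t, 0 < t ∧ HasDerivAt (cgf Y μ) a t := by
  obtain ⟨t₁, ht₁, hlt⟩ := exists_pos_cgf_lt hY hexp ha
  set g : ℝ → ℝ := fun t => t * a - cgf Y μ t with hg
  have hg₁ : 0 < g t₁ := by simp only [hg]; linarith
  set e := ∫ ω, Y ω ∂μ
  have hinter : ∀ t, 0 < t → t ∈ interior (integrableExpSet Y μ) := fun t ht =>
    interior_mono (s := Set.Ici 0) (fun s hs => hexp s hs) (by rwa [interior_Ici])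
  -- The maximum of `g` is sought on an interval with a positive left end, since analyticity is
  -- known only for `t > 0`. Jensen's inequality makes `g` small near 0.
  have hsmall : ∃ s, 0 < s ∧ s < t₁ ∧ g s < g t₁ := by
    refine ⟨min (t₁ / 2) (g t₁ / (2 * (a - e))), ?_, ?_, ?_⟩
    · exact lt_min (by positivity) (div_pos hg₁ (by linarith))
    · exact (min_le_left _ _).trans_lt (by linarith)
    · set s := min (t₁ / 2) (g t₁ / (2 * (a - e)))
      have hs : 0 < s := lt_min (by positivity) (div_pos hg₁ (by linarith))
      have hJ := mul_integral_le_cgf hY (hexp s hs.le)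
      have h2 : s * (a - e) ≤ g t₁ / 2 := by
        have := mul_le_mul_of_nonneg_right (min_le_right (t₁ / 2) (g t₁ / (2 * (a - e))))
          (show 0 ≤ a - e by linarith)
        refine this.trans (le_of_eq ?_)
        have : a - e ≠ 0 := by linarith
        field_simp
      have : g s ≤ s * (a - e) := by
        change s * a - cgf Y μ s ≤ _
        linarith
      linarith
  obtain ⟨s, hs0, hst, hgs⟩ := hsmall
  set p := Real.log (μ.real {ω | b ≤ Y ω})
  -- The mass above `b > a` gives `cgf ≥ T b + p`, so for this `T` one gets `g T ≤ 0`. The maximum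
  -- is therefore interior and `g' = 0` there.
  set T := max (t₁ + 1) (-p / (b - a))
  have hT1 : t₁ < T := lt_of_lt_of_le (by linarith) (le_max_left _ _)
  have hgT : g T ≤ 0 := by
    have h1 : T * b + p ≤ cgf Y μ T :=
      le_cgf_of_measureReal_pos (by linarith) (hexp T (by linarith)) hp
    have h2 : -p ≤ T * (b - a) := by
      rw [← div_le_iff₀ (by linarith)]; exact le_max_right _ _
    change T * a - cgf Y μ T ≤ 0
    linarith
  have hcont : ContinuousOn g (Set.Icc s T) := fun t ht =>
    (((continuous_id.mul continuous_const).continuousAt).sub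
      (analyticAt_cgf (hinter t (hs0.trans_le ht.1))).continuousAt).continuousWithinAt
  obtain ⟨t₀, ht₀, hmax⟩ := isCompact_Icc.exists_isMaxOn ⟨t₁, hst.le, hT1.le⟩ hcont
  have hm1 : g t₁ ≤ g t₀ := hmax ⟨hst.le, hT1.le⟩
  have h1 : s < t₀ := lt_of_le_of_ne ht₀.1 (by rintro rfl; linarith)
  have h2 : t₀ < T := lt_of_le_of_ne ht₀.2 (by rintro h; rw [h] at hm1; linarith)
  have ht₀pos : 0 < t₀ := hs0.trans h1
  refine ⟨t₀, ht₀pos, ?_⟩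
  have hd := (analyticAt_cgf (hinter t₀ ht₀pos)).differentiableAt.hasDerivAt
  have hdg : HasDerivAt g (1 * a - deriv (cgf Y μ) t₀) t₀ :=
    ((hasDerivAt_id t₀).mul_const a).sub hd
  have hz := (hmax.isLocalMax (Icc_mem_nhds h1 h2)).hasDerivAt_eq_zero hdg
  have : deriv (cgf Y μ) t₀ = a := by linarith
  rwa [this] at hd

/-- A finite value of the Cramér transform at `a` forces mass above every `b < a`. -/
theorem measureReal_ge_pos_of_cramer_le {X : Ω → ℝ} (hX : Measurable X) {a b v : ℝ} (hba : b < a)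
    (hv : ∀ t ∈ expDomain μ X, a * t - cgf X μ t ≤ v) : 0 < μ.real {ω | b ≤ X ω} := by
  by_contra hcon
  have hz : μ.real {ω | b ≤ X ω} = 0 := le_antisymm (not_lt.1 hcon) measureReal_nonneg
  have hae : ∀ᵐ ω ∂μ, X ω ≤ b := by
    rw [measureReal_eq_zero_iff] at hz
    have : ∀ᵐ ω ∂μ, ¬ b ≤ X ω := by rw [ae_iff]; simpa using hz
    filter_upwards [this] with ω hω using (not_le.1 hω).le
  -- If `X ≤ b` almost surely then `cgf t ≤ t b`, so the transform at `a` is at least `t (a - b) =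
  -- |v| + 1`.
  set t := (|v| + 1) / (a - b)
  have hpos : 0 < a - b := by linarith
  have ht : 0 ≤ t := by positivity
  have hi : Integrable (fun ω => Real.exp (t * X ω)) μ :=
    integrable_exp_mul_of_le t b ht hX.aemeasurable hae
  have h1 := hv t ⟨ht, hi⟩
  have h2 : cgf X μ t ≤ t * b := by
    rw [cgf, Real.log_le_iff_le_exp (mgf_pos hi)]
    calc mgf X μ t ≤ ∫ _, Real.exp (t * b) ∂μ :=
          integral_mono_ae hi (integrable_const _) (by
            filter_upwards [hae] with ω hω
            exact Real.exp_le_exp.2 (mul_le_mul_of_nonneg_left hω ht))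
      _ = Real.exp (t * b) := by simp
  have h3 : t * (a - b) = |v| + 1 := by simp only [t]; field_simp
  linarith [le_abs_self v]

/-- Truncation from above changes the Cramér transform only slightly. -/
theorem exists_truncation {X : Ω → ℝ} (hX : Measurable X) {a a₁ v ε : ℝ} (ha : a₁ < a)
    (hε : 0 < ε) (hv : ∀ t ∈ expDomain μ X, a * t - cgf X μ t ≤ v) (M₀ : ℕ) :
    ∃ M : ℕ, M₀ ≤ M ∧ ∀ t, 0 ≤ t → a₁ * t - cgf (fun ω => min (X ω) M) μ t ≤ v + ε := by
  by_contra! hcon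
  set b := (a₁ + a) / 2 with hb
  have hb1 : a₁ < b := by linarith
  have hp := measureReal_ge_pos_of_cramer_le hX (show b < a by linarith) hv
  set p := Real.log (μ.real {ω | b ≤ X ω})
  set M₁ := max M₀ ⌈b⌉₊
  choose t ht0 ht using fun n : ℕ => hcon (M₁ + n) ((le_max_left _ _).trans (Nat.le_add_right _ _))
  have hM₁ : ∀ n : ℕ, b ≤ ((M₁ + n : ℕ) : ℝ) := fun n =>
    (Nat.le_ceil b).trans (by exact_mod_cast (le_max_right M₀ ⌈b⌉₊).trans (Nat.le_add_right _ _))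
  -- The mass above `b` is unaffected by the truncation levels used here, which bounds the violating
  -- exponents uniformly and lets a subsequence converge.
  set T := max 0 ((-p - (v + ε)) / (b - a₁))
  have htT : ∀ n, t n ∈ Set.Icc 0 T := by
    intro n
    refine ⟨ht0 n, le_max_of_le_right ?_⟩
    have hset : {ω | b ≤ min (X ω) ((M₁ + n : ℕ) : ℝ)} = {ω | b ≤ X ω} := by
      ext ω
      simp only [Set.mem_ofPred_eq, le_min_iff, hM₁ n, and_true]
    have h1 := le_cgf_of_measureReal_pos (Y := fun ω => min (X ω) ((M₁ + n : ℕ) : ℝ)) (b := b)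
      (ht0 n) (integrable_exp_mul_min hX _ (ht0 n)) (by rw [hset]; exact hp)
    rw [hset] at h1
    rw [le_div_iff₀ (by linarith)]
    linarith [ht n]
  obtain ⟨s, hs, k, hk, hks⟩ := isCompact_Icc.tendsto_subseq htT
  -- Fatou shows both that the limit exponent `s` lies in `expDomain` and that the violation
  -- survives there, against `hv`.
  have hFatou := lintegral_liminf_le (μ := μ) (u := atTop) (f := fun (n : ℕ) ω =>
    ENNReal.ofReal (Real.exp (t (k n) * min (X ω) ((M₁ + k n : ℕ) : ℝ)))) (fun n => by fun_prop)
  have hpt : ∀ ω, liminf (fun n : ℕ => ENNReal.ofReal (Real.exp (t (k n) *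
      min (X ω) ((M₁ + k n : ℕ) : ℝ)))) atTop = ENNReal.ofReal (Real.exp (s * X ω)) := by
    intro ω
    refine Tendsto.liminf_eq (ENNReal.tendsto_ofReal ((Real.continuous_exp.tendsto _).comp
      (hks.mul ?_)))
    refine tendsto_const_nhds.congr' ?_
    filter_upwards [hk.tendsto_atTop.eventually_ge_atTop ⌈X ω⌉₊] with n hn
    refine (min_eq_left ((Nat.le_ceil _).trans ?_)).symm
    exact_mod_cast hn.trans (Nat.le_add_left _ _)
  have hright : liminf (fun n : ℕ => ∫⁻ ω, ENNReal.ofReal (Real.exp (t (k n) *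
      min (X ω) ((M₁ + k n : ℕ) : ℝ))) ∂μ) atTop ≤ ENNReal.ofReal (Real.exp (a₁ * s - (v + ε))) := by
    have hl : Tendsto (fun n : ℕ => ENNReal.ofReal (Real.exp (a₁ * t (k n) - (v + ε)))) atTop
        (𝓝 (ENNReal.ofReal (Real.exp (a₁ * s - (v + ε))))) :=
      ENNReal.tendsto_ofReal ((Real.continuous_exp.tendsto _).comp
        ((hks.const_mul a₁).sub_const _))
    rw [← hl.liminf_eq]
    refine liminf_le_liminf (Eventually.of_forall fun n => ?_)
    have hi := integrable_exp_mul_min (μ := μ) hX ((M₁ + k n : ℕ) : ℝ) (ht0 (k n))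
    rw [← ofReal_integral_eq_lintegral_ofReal hi
      (Eventually.of_forall fun ω => (Real.exp_pos _).le)]
    refine ENNReal.ofReal_le_ofReal ?_
    change mgf (fun ω => min (X ω) ((M₁ + k n : ℕ) : ℝ)) μ (t (k n)) ≤ _
    rw [← exp_cgf hi, Real.exp_le_exp]
    linarith [ht (k n)]
  simp only [hpt] at hFatou
  have hle := hFatou.trans hright
  have hi : Integrable (fun ω => Real.exp (s * X ω)) μ := by
    refine ⟨(by fun_prop : Measurable fun ω => Real.exp (s * X ω)).aestronglyMeasurable, ?_⟩
    rw [hasFiniteIntegral_iff_ofReal (Eventually.of_forall fun ω => (Real.exp_pos _).le)]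
    exact hle.trans_lt ENNReal.ofReal_lt_top
  rw [← ofReal_integral_eq_lintegral_ofReal hi
      (Eventually.of_forall fun ω => (Real.exp_pos _).le),
    ENNReal.ofReal_le_ofReal_iff (Real.exp_pos _).le] at hle
  change mgf X μ s ≤ _ at hle
  rw [← exp_cgf hi, Real.exp_le_exp] at hle
  have := hv s ⟨hs.1, hi⟩
  have := mul_le_mul_of_nonneg_right ha.le hs.1
  linarith

/-- The lower bound in Cramér's theorem. -/
theorem exp_le_measureReal_sum_ge {X : ℕ → Ω → ℝ} (hX : ∀ j, Measurable (X j))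
    (hindep : iIndepFun X μ) (hident : ∀ j, IdentDistrib (X j) (X 0) μ μ)
    (hint : Integrable (X 0) μ) (hmean : ∫ ω, X 0 ω ∂μ = 0) {a a' v ε : ℝ} (ha : a' < a)
    (hv : ∀ t ∈ expDomain μ (X 0), a * t - cgf (X 0) μ t ≤ v) (hε : 0 < ε) :
    ∀ᶠ n : ℕ in atTop, Real.exp (-(n * (v + ε))) ≤
      μ.real {ω | n * a' ≤ ∑ j ∈ Finset.range n, X j ω} := by
  have hv0 : 0 ≤ v := by simpa using hv 0 zero_mem_expDomain
  rcases lt_or_ge a' 0 with hneg | hpos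
  · -- the law of large numbers
    have hlln := strong_law_ae_real X hint (fun i j hij => hindep.indepFun hij) hident
    rw [hmean] at hlln
    have hmeas : ∀ n : ℕ, Measurable fun ω => (∑ j ∈ Finset.range n, X j ω) / (n : ℝ) := fun n =>
      (Finset.measurable_fun_sum _ fun j _ => hX j).div_const _
    have htm := tendstoInMeasure_of_tendsto_ae
      (fun n => (hmeas n).aestronglyMeasurable) hlln
    have h1 := (tendstoInMeasure_iff_norm.1 htm) (-a') (by linarith)
    have h2 := (ENNReal.tendsto_toReal ENNReal.zero_ne_top).comp h1
    simp only [ENNReal.toReal_zero, sub_zero] at h2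
    have hexp : Tendsto (fun n : ℕ => Real.exp (-(n * (v + ε)))) atTop (𝓝 0) :=
      Real.tendsto_exp_neg_atTop_nhds_zero.comp
        (tendsto_natCast_atTop_atTop.atTop_mul_const (by linarith))
    filter_upwards [h2.eventually (gt_mem_nhds (show (0 : ℝ) < 1 / 2 by norm_num)),
      hexp.eventually (gt_mem_nhds (show (0 : ℝ) < 1 / 2 by norm_num)), eventually_gt_atTop 0]
      with n hn1 hn2 hn3
    have hn : (0 : ℝ) < n := by exact_mod_cast hn3
    have hsub : {ω | n * a' ≤ ∑ j ∈ Finset.range n, X j ω}ᶜ ⊆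
        {ω | -a' ≤ ‖(∑ j ∈ Finset.range n, X j ω) / (n : ℝ)‖} := by
      intro ω hω
      simp only [Set.mem_compl_iff, Set.mem_ofPred_eq, not_le] at hω
      have : (∑ j ∈ Finset.range n, X j ω) / (n : ℝ) ≤ a' := by
        rw [div_le_iff₀ hn]; linarith
      simp only [Set.mem_ofPred_eq, Real.norm_eq_abs]
      exact (by linarith : -a' ≤ -((∑ j ∈ Finset.range n, X j ω) / (n : ℝ))).trans (neg_le_abs _)
    have hms : MeasurableSet {ω | n * a' ≤ ∑ j ∈ Finset.range n, X j ω} :=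
      measurableSet_le measurable_const (Finset.measurable_fun_sum _ fun j _ => hX j)
    have h3 := measureReal_mono (μ := μ) hsub
    rw [probReal_compl_eq_one_sub hms] at h3
    have h4 : μ.real {ω | -a' ≤ ‖(∑ j ∈ Finset.range n, X j ω) / (n : ℝ)‖} < 1 / 2 := hn1
    linarith
  -- Since `Y ≤ X`, a lower bound for the truncated sums suffices. The truncated variable has all
  -- moments with `t ≥ 0`, and its mean is at most `0 < a₁`, so some tilt has derivative exactly
  -- `a₁`.
  · set a₁ := (a' + a) / 2 with ha₁
    have ha₁a : a₁ < a := by linarith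
    have ha₁' : a' < a₁ := by linarith
    set b := (a₁ + a) / 2 with hb
    obtain ⟨M, hM₀, hM⟩ := exists_truncation (hX 0) ha₁a (half_pos hε) hv ⌈b⌉₊
    have hbM : b ≤ M := (Nat.le_ceil b).trans (by exact_mod_cast hM₀)
    set Y : ℕ → Ω → ℝ := fun j ω => min (X j ω) M with hYdef
    have hYm : ∀ j, Measurable (Y j) := fun j => (hX j).min measurable_const
    have hYind : iIndepFun Y μ :=
      hindep.comp (fun _ x => min x (M : ℝ)) fun _ => measurable_id.min measurable_const
    have hYid : ∀ j, IdentDistrib (Y j) (Y 0) μ μ := fun j =>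
      (hident j).comp (measurable_id.min measurable_const : Measurable fun x : ℝ => min x (M : ℝ))
    have hYexp : ∀ j t, 0 ≤ t → Integrable (fun ω => Real.exp (t * Y j ω)) μ := fun j t ht =>
      integrable_exp_mul_min (hX j) _ ht
    have hYint : Integrable (Y 0) μ := hint.inf (integrable_const _)
    have hYmean : ∫ ω, Y 0 ω ∂μ < a₁ := by
      have : ∫ ω, Y 0 ω ∂μ ≤ ∫ ω, X 0 ω ∂μ :=
        integral_mono hYint hint fun ω => min_le_left _ _
      linarith
    have hYp : 0 < μ.real {ω | b ≤ Y 0 ω} := by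
      have := measureReal_ge_pos_of_cramer_le (hX 0) (show b < a by linarith) hv
      convert this using 4
      simp only [hYdef, le_min_iff, hbM, and_true]
    obtain ⟨t₀, ht₀, hderiv⟩ := exists_hasDerivAt_cgf hYint (hYexp 0) hYmean
      (show a₁ < b by linarith) hYp
    have hsumcgf : ∀ (n : ℕ) t, 0 ≤ t →
        cgf (fun ω => ∑ j ∈ Finset.range n, Y j ω) μ t = n * cgf (Y 0) μ t := by
      intro n t ht
      have h1 := hYind.cgf_sum hYm (s := Finset.range n) (fun j _ => hYexp j t ht)
      rw [show (fun ω => ∑ j ∈ Finset.range n, Y j ω) = ∑ j ∈ Finset.range n, Y j by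
        ext ω; simp, h1]
      simp [cgf, mgf_congr_of_identDistrib (Y _) (Y 0) (hYid _) t]
    have hpos₀ : ∀ᶠ t in 𝓝 t₀, 0 ≤ t := (lt_mem_nhds ht₀).mono fun _ h => le_of_lt h
    have hld := exp_le_measureReal_abs_sub_lt (μ := μ)
      (Z := fun n ω => ∑ j ∈ Finset.range n, Y j ω)
      (fun n => Finset.measurable_fun_sum _ fun j _ => hYm j) hderiv
      (hpos₀.mono fun t ht => Eventually.of_forall fun n => by
        have := hYind.integrable_exp_mul_sum hYm (s := Finset.range n) (t := t)
          (fun j _ => hYexp j t ht)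
        simpa using this)
      (hpos₀.mono fun t ht => by
        refine tendsto_const_nhds.congr' ?_
        filter_upwards [eventually_gt_atTop 0] with n hn
        have hn' : (n : ℝ) ≠ 0 := by exact_mod_cast hn.ne'
        rw [hsumcgf n t ht, mul_div_cancel_left₀ _ hn'])
      (show 0 < a₁ - a' by linarith) (half_pos hε)
    filter_upwards [hld] with n hn
    have hn0 : (0 : ℝ) ≤ n := Nat.cast_nonneg n
    calc Real.exp (-(n * (v + ε)))
        ≤ Real.exp (-(n * (t₀ * a₁ - cgf (Y 0) μ t₀ + ε / 2))) := by
          refine Real.exp_le_exp.2 (neg_le_neg (mul_le_mul_of_nonneg_left ?_ hn0))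
          have : a₁ * t₀ - cgf (Y 0) μ t₀ ≤ v + ε / 2 := hM t₀ ht₀.le
          linarith
      _ ≤ _ := hn
      _ ≤ _ := by
          refine measureReal_mono fun ω hω => ?_
          have h1 : |(∑ j ∈ Finset.range n, Y j ω) - n * a₁| < n * (a₁ - a') := hω
          have h2 : ∑ j ∈ Finset.range n, Y j ω ≤ ∑ j ∈ Finset.range n, X j ω :=
            Finset.sum_le_sum fun j _ => min_le_left _ _
          have h3 := (abs_lt.1 h1).1
          change n * a' ≤ ∑ j ∈ Finset.range n, X j ω
          linarith

end CramerLowerBound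

/-! ### Choosing the typical length and the level of the summands -/

section Tilt

variable {D : Set ℝ} {c χ : ℝ → ℝ}

theorem div_le_deriv_of_convexOn (hχ : ConvexOn ℝ (Set.Ici 0) χ) (hχ0 : χ 0 = 0) {t : ℝ} (ht : 0 < t)
    (hd : DifferentiableAt ℝ χ t) : χ t ≤ t * deriv χ t := by
  have h := hχ.slope_le_of_hasDerivAt (Set.mem_Ici.2 le_rfl) (Set.mem_Ici.2 ht.le) ht hd.hasDerivAt
  rw [slope_def_field, hχ0, sub_zero, sub_zero, div_le_iff₀ ht] at h
  linarith

theorem mul_deriv_le_of_convexOn (hχ : ConvexOn ℝ (Set.Ici 0) χ) {t : ℝ} (ht : 0 < t)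
    (hd : DifferentiableAt ℝ χ t) : t * deriv χ t ≤ χ (2 * t) - χ t := by
  have h := hχ.le_slope_of_hasDerivAt (Set.mem_Ici.2 ht.le)
    (Set.mem_Ici.2 (show 0 ≤ 2 * t by linarith)) (by linarith) hd.hasDerivAt
  rw [slope_def_field, le_div_iff₀ (by linarith)] at h
  linarith

/-- A finite upper bound `v` of the saddle function is nearly attained at a point `y = χ' t` of the
range of the derivative of `χ`. -/
theorem exists_tilt (hD0 : (0 : ℝ) ∈ D) (hc : ConvexOn ℝ D c)
    (hc0 : c 0 = 0) (hc_nonneg : ∀ t ∈ D, 0 ≤ c t) (hχ : ConvexOn ℝ (Set.Ici 0) χ)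
    (hχ_mono : MonotoneOn χ (Set.Ici 0)) (hχ0 : χ 0 = 0) (hχ_le : ∀ t, 0 ≤ t → t ≤ χ t)
    (hχ_diff : ∀ t, 0 < t → DifferentiableAt ℝ χ t)
    {x x' v ε : ℝ} (h : ∀ t ∈ D, x * t - χ (c t) ≤ v) (hx : x' < x) (hε : 0 < ε) :
    ∃ t₁ y₁ a₁ B : ℝ, 0 < t₁ ∧ 0 < y₁ ∧ HasDerivAt χ y₁ t₁ ∧ x' < y₁ * a₁ ∧ 0 ≤ B ∧
      (∀ t ∈ D, a₁ * t - c t ≤ B) ∧ t₁ * y₁ - χ t₁ + y₁ * B ≤ v + ε := by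
  obtain ⟨y, hy1, hy⟩ := exists_saddle hD0 hc hc0 hc_nonneg hχ hχ_mono hχ0 hχ_le h
  have hy0 : 0 < y := by linarith
  -- `A` is the cost `ψ y` of the length; `B` is what the total `v` leaves per summand.
  set A := sSup ((fun s => y * s - χ s) '' Set.Ici 0) with hA
  have hne : ((fun s => y * s - χ s) '' Set.Ici (0 : ℝ)).Nonempty := ⟨_, 0, Set.mem_Ici.2 le_rfl, rfl⟩
  have hbd : ∀ t ∈ D, ∀ r ∈ (fun s => y * s - χ s) '' Set.Ici (0 : ℝ),
      r ≤ v - (x * t - y * c t) := by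
    rintro t ht _ ⟨s, hs, rfl⟩
    have := hy s hs t ht
    simp only
    linarith
  have hAs : ∀ s, 0 ≤ s → y * s - χ s ≤ A := fun s hs =>
    le_csSup ⟨_, fun r hr => hbd 0 hD0 r hr⟩ ⟨s, hs, rfl⟩
  have hAv : ∀ t ∈ D, A ≤ v - (x * t - y * c t) := fun t ht => csSup_le hne (hbd t ht)
  have hA0 : 0 ≤ A := by simpa [hχ0] using hAs 0 le_rfl
  set B := (v - A) / y with hB
  have hyB : y * B = v - A := by rw [hB]; field_simp
  have hB0 : 0 ≤ B := by
    have := hAv 0 hD0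
    rw [hc0] at this
    exact div_nonneg (by linarith) hy0.le
  have hd1 : ∀ t, 0 < t → 1 ≤ deriv χ t := fun t ht => by
    have h1 := div_le_deriv_of_convexOn hχ hχ0 ht (hχ_diff t ht)
    have h2 := hχ_le t ht.le
    by_contra hlt
    nlinarith [mul_lt_mul_of_pos_left (not_le.1 hlt) ht]
  have hxy : ∀ t ∈ D, x / y * t - c t ≤ B := fun t ht => by
    rw [hB, le_div_iff₀ hy0]
    have e : (x / y * t - c t) * y = x * t - y * c t := by field_simp
    linarith [hAv t ht]
  -- If `y` lies below all slopes, a slope at a small `t₁` is used. Its cost is at most `χ (2 t₁) -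
  -- 2 χ t₁`, which is small, and enlarging `y` only relaxes the constraint on the summands because
  -- `c ≥ 0`.
  by_cases hlow : ∀ t, 0 < t → y < deriv χ t
  · set t₁ := min (1 / 2) (ε / (2 * (χ 1 + 1))) with ht₁
    have hχ1 : 0 < χ 1 := by linarith [hχ_le 1 zero_le_one]
    have ht₁0 : 0 < t₁ := lt_min (by norm_num) (by positivity)
    have ht₁1 : t₁ ≤ 1 / 2 := min_le_left _ _
    set y₁ := deriv χ t₁
    have hyy : y < y₁ := hlow t₁ ht₁0
    have hy₁ : 0 < y₁ := hy0.trans hyy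
    refine ⟨t₁, y₁, x / y₁, y * B / y₁, ht₁0, hy₁, (hχ_diff t₁ ht₁0).hasDerivAt, ?_, by positivity,
      fun t ht => ?_, ?_⟩
    · rw [mul_div_cancel₀ _ hy₁.ne']; exact hx
    · rw [le_div_iff₀ hy₁]
      have e : (x / y₁ * t - c t) * y₁ = x * t - y₁ * c t := by field_simp
      have := mul_le_mul_of_nonneg_right hyy.le (hc_nonneg t ht)
      linarith [hAv t ht]
    · have e : y₁ * (y * B / y₁) = v - A := by rw [← hyB]; field_simp
      have h1 := mul_deriv_le_of_convexOn hχ ht₁0 (hχ_diff t₁ ht₁0)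
      have h2 := hχ.2 (Set.mem_Ici.2 (le_refl (0 : ℝ))) (Set.mem_Ici.2 (zero_le_one (α := ℝ)))
        (show 0 ≤ 1 - 2 * t₁ by linarith) (show 0 ≤ 2 * t₁ by linarith) (by ring)
      simp only [smul_eq_mul, mul_zero, zero_add, mul_one, hχ0] at h2
      have h3 : t₁ * (2 * (χ 1 + 1)) ≤ ε := by
        rw [← le_div_iff₀ (by linarith)]; exact min_le_right _ _
      have h4 := hχ_le t₁ ht₁0.le
      change t₁ * y₁ ≤ _ at h1
      linarith
  -- If `y` lies above all slopes it must be their supremum: slopes at most `l < y` would make `y t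
  -- - χ t` unbounded. A slope close to `y` loses only `x - x'`.
  by_cases hhigh : ∀ t, 0 < t → deriv χ t < y
  · have hcont : Tendsto (fun y' : ℝ => y' * (x / y)) (𝓝[<] y) (𝓝 x) := by
      have : Tendsto (fun y' : ℝ => y' * (x / y)) (𝓝 y) (𝓝 (y * (x / y))) :=
        (continuous_mul_const (x / y)).tendsto y
      rw [mul_div_cancel₀ _ hy0.ne'] at this
      exact this.mono_left nhdsWithin_le_nhds
    obtain ⟨l, hl, hlI⟩ := mem_nhdsLT_iff_exists_Ioo_subset.1
      (hcont.eventually (lt_mem_nhds hx))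
    have hl' : l < y := hl
    have : ∃ t, 0 < t ∧ l < deriv χ t := by
      by_contra! hcon
      set t := (A + 1) / (y - l)
      have hpos : 0 < y - l := by linarith
      have ht : 0 < t := by positivity
      have h1 := div_le_deriv_of_convexOn hχ hχ0 ht (hχ_diff t ht)
      have h2 := mul_le_mul_of_nonneg_left (hcon t ht) ht.le
      have h3 := hAs t ht.le
      have h4 : t * (y - l) = A + 1 := by simp only [t]; field_simp
      linarith
    obtain ⟨t₁, ht₁, hlt⟩ := this
    refine ⟨t₁, deriv χ t₁, x / y, B, ht₁, by linarith [hd1 t₁ ht₁], (hχ_diff t₁ ht₁).hasDerivAt,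
      hlI ⟨hlt, hhigh t₁ ht₁⟩, hB0, hxy, ?_⟩
    have h1 := hAs t₁ ht₁.le
    have h2 := mul_le_mul_of_nonneg_left (hhigh t₁ ht₁).le ht₁.le
    have h3 := mul_le_mul_of_nonneg_right (hhigh t₁ ht₁).le hB0
    linarith
  push Not at hlow hhigh
  obtain ⟨s₁, hs₁, hs₁y⟩ := hlow
  obtain ⟨s₂, hs₂, hs₂y⟩ := hhigh
  -- Darboux's theorem: between two slopes, `y` itself is a slope.
  have hoc := (Convex.image_deriv (convex_Ioi (0 : ℝ)) (f := χ) fun t ht => hχ_diff t ht).ordConnected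
  obtain ⟨t₁, ht₁, heq⟩ := hoc.out (Set.mem_image_of_mem _ hs₁) (Set.mem_image_of_mem _ hs₂)
    ⟨hs₁y, hs₂y⟩
  refine ⟨t₁, y, x / y, B, ht₁, hy0, heq ▸ (hχ_diff t₁ ht₁).hasDerivAt, ?_, hB0, hxy, ?_⟩
  · rw [mul_div_cancel₀ _ hy0.ne']; exact hx
  · linarith [hAs t₁ (le_of_lt ht₁)]

end Tilt

/-! ### The model and the inherited properties of `χ` -/

variable {Ω : Type*} [MeasurableSpace Ω]

/-- The assumptions on the two families `η` and `lam`. -/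
structure IsModel (μ : Measure Ω) (η : ℕ → ℕ → Ω → ℝ) (lam : ℕ → ℕ → Ω → ℕ) (χ : ℝ → ℝ) : Prop where
  meas_η : ∀ i j, Measurable (η i j)
  indep_η : iIndepFun (fun p : ℕ × ℕ => η p.1 p.2) μ
  ident_η : ∀ i j, IdentDistrib (η i j) (η 0 0) μ μ
  int_η : Integrable (η 0 0) μ
  mean_η : ∫ ω, η 0 0 ω ∂μ = 0
  exp_η : ∃ t : ℝ, 0 < t ∧ Integrable (fun ω => Real.exp (t * η 0 0 ω)) μ
  meas_lam : ∀ i m, Measurable (lam i m)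
  indep_lam : iIndepFun (fun p : ℕ × ℕ => lam p.1 p.2) μ
  ident_lam : ∀ i m, IdentDistrib (lam i m) (lam 0 m) μ μ
  int_lam : ∀ m, 1 ≤ m → Integrable (fun ω => (lam 0 m ω : ℝ)) μ
  mean_lam : ∀ m, 1 ≤ m → ∫ ω, (lam 0 m ω : ℝ) ∂μ = m
  indep : IndepFun (fun ω (p : ℕ × ℕ) => η p.1 p.2 ω) (fun ω (p : ℕ × ℕ) => lam p.1 p.2 ω) μ
  int_exp_lam : ∀ t : ℝ, 0 ≤ t →
    ∀ᶠ m : ℕ in atTop, Integrable (fun ω => Real.exp (t * (lam 0 m ω : ℝ))) μ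
  tendsto_cgf_lam : ∀ t : ℝ, 0 ≤ t →
    Tendsto (fun m : ℕ => cgf (fun ω => (lam 0 m ω : ℝ)) μ t / m) atTop (𝓝 (χ t))
  diff_χ : ∀ t : ℝ, 0 < t → DifferentiableAt ℝ χ t

namespace IsModel

variable {μ : Measure Ω} [IsProbabilityMeasure μ] {η : ℕ → ℕ → Ω → ℝ} {lam : ℕ → ℕ → Ω → ℕ}
  {χ : ℝ → ℝ}

theorem chi_zero (h : IsModel μ η lam χ) : χ 0 = 0 := by
  refine tendsto_nhds_unique (h.tendsto_cgf_lam 0 le_rfl) ?_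
  simp

/-- Jensen's inequality with mean `m`. This bound is what allows the saddle point `y ≥ 1`. -/
theorem le_chi (h : IsModel μ η lam χ) {t : ℝ} (ht : 0 ≤ t) : t ≤ χ t := by
  refine ge_of_tendsto (h.tendsto_cgf_lam t ht) ?_
  filter_upwards [h.int_exp_lam t ht, eventually_ge_atTop 1] with m hm hm1
  have hm0 : (0 : ℝ) < m := by exact_mod_cast hm1
  rw [le_div_iff₀ hm0]
  have := mul_integral_le_cgf (h.int_lam m hm1) hm
  rwa [h.mean_lam m hm1] at this

theorem monotoneOn_chi (h : IsModel μ η lam χ) : MonotoneOn χ (Set.Ici 0) := by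
  intro s hs t ht hst
  refine le_of_tendsto_of_tendsto (h.tendsto_cgf_lam s hs) (h.tendsto_cgf_lam t ht) ?_
  filter_upwards [h.int_exp_lam s hs, h.int_exp_lam t ht] with m h1 h2
  refine div_le_div_of_nonneg_right ?_ (Nat.cast_nonneg m)
  refine Real.log_le_log (mgf_pos h1) (integral_mono h1 h2 fun ω => Real.exp_le_exp.2 ?_)
  exact mul_le_mul_of_nonneg_right hst (Nat.cast_nonneg _)

theorem convexOn_chi (h : IsModel μ η lam χ) : ConvexOn ℝ (Set.Ici 0) χ := by
  refine ⟨convex_Ici 0, fun s hs t ht p r hp hr hpr => ?_⟩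
  have hst : 0 ≤ p • s + r • t := convex_Ici (0 : ℝ) hs ht hp hr hpr
  refine le_of_tendsto_of_tendsto (h.tendsto_cgf_lam _ hst)
    (((h.tendsto_cgf_lam s hs).const_smul p).add ((h.tendsto_cgf_lam t ht).const_smul r)) ?_
  filter_upwards [h.int_exp_lam s hs, h.int_exp_lam t ht] with m h1 h2
  have := convexOn_cgf.2 h1 h2 hp hr hpr
  simp only [smul_eq_mul] at this ⊢
  rw [← mul_div_assoc, ← mul_div_assoc, ← add_div]
  exact div_le_div_of_nonneg_right this (Nat.cast_nonneg m)

theorem cgf_nonneg (h : IsModel μ η lam χ) {t : ℝ} (ht : t ∈ expDomain μ (η 0 0)) :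
    0 ≤ cgf (η 0 0) μ t := by
  have := mul_integral_le_cgf h.int_η ht.2
  rwa [h.mean_η, mul_zero] at this

theorem nu_le_iff (h : IsModel μ η lam χ) {x v : ℝ} :
    nu (cramer μ (η 0 0)) (legendre χ) x ≤ v ↔
      ∀ t ∈ expDomain μ (η 0 0), x * t - χ (cgf (η 0 0) μ t) ≤ v :=
  RandomProducts.nu_le_iff (fun _ ht => h.cgf_nonneg ht) h.convexOn_chi h.monotoneOn_chi h.chi_zero
    fun _ ht => h.le_chi ht

end IsModel

/-! ### Tail probabilities of the random sums -/

theorem tsum_measure_inter_preimage_singleton {β : Type*} [Countable β] [MeasurableSpace β]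
    [MeasurableSingletonClass β] {μ : Measure Ω} {L : Ω → β} (hL : Measurable L) (s : Set Ω) :
    ∑' b, μ (s ∩ L ⁻¹' {b}) = μ s := by
  have h : ∀ b, MeasurableSet (L ⁻¹' {b}) := fun b => hL (measurableSet_singleton b)
  have h2 := measure_iUnion (μ := μ.restrict s) (f := fun b => L ⁻¹' {b})
    (fun a b hab => Disjoint.preimage L (by simpa using hab)) h
  rw [← Set.preimage_iUnion, Set.iUnion_of_singleton, Set.preimage_univ,
    Measure.restrict_apply_univ] at h2
  rw [h2]
  refine tsum_congr fun b => ?_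
  rw [Measure.restrict_apply (h b), Set.inter_comm]

namespace IsModel

variable {μ : Measure Ω} [IsProbabilityMeasure μ] {η : ℕ → ℕ → Ω → ℝ} {lam : ℕ → ℕ → Ω → ℕ}
  {χ : ℝ → ℝ}

theorem measurable_sum (h : IsModel μ η lam χ) (i n : ℕ) :
    Measurable fun ω => ∑ j ∈ Finset.range n, η i j ω :=
  Finset.measurable_fun_sum _ fun j _ => h.meas_η i j

theorem measurable_R (h : IsModel μ η lam χ) (i m : ℕ) : Measurable (R η lam i m) :=
  (measurable_from_prod_countable_right (f := fun p : ℕ × Ω => ∑ j ∈ Finset.range p.1, η i j p.2)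
    fun n => h.measurable_sum i n).comp ((h.meas_lam i m).prodMk measurable_id)

theorem measurableSet_tail (h : IsModel μ η lam χ) (i m : ℕ) (c : ℝ) :
    MeasurableSet {ω | c ≤ R η lam i m ω} :=
  measurableSet_le measurable_const (h.measurable_R i m)

/-- Distribution of a random sum. -/
theorem measure_tail_R (h : IsModel μ η lam χ) (i m : ℕ) (c : ℝ) :
    μ {ω | c ≤ R η lam i m ω} =
      ∑' n, μ (lam i m ⁻¹' {n}) * μ {ω | c ≤ ∑ j ∈ Finset.range n, η i j ω} := by
  rw [← tsum_measure_inter_preimage_singleton (h.meas_lam i m)]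
  refine tsum_congr fun n => ?_
  have e : {ω | c ≤ R η lam i m ω} ∩ lam i m ⁻¹' {n} =
      {ω | c ≤ ∑ j ∈ Finset.range n, η i j ω} ∩ lam i m ⁻¹' {n} := by
    ext ω
    simp only [Set.mem_inter_iff, Set.mem_ofPred_eq, Set.mem_preimage, Set.mem_singleton_iff, R]
    constructor <;> rintro ⟨h1, h2⟩ <;> refine ⟨?_, h2⟩ <;> simpa [h2] using h1
  rw [e, mul_comm]
  exact h.indep.measure_inter_preimage_eq_mul
    {e : ℕ × ℕ → ℝ | c ≤ ∑ j ∈ Finset.range n, e (i, j)} ((fun l : ℕ × ℕ → ℕ => l (i, m)) ⁻¹' {n})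
    (measurableSet_le measurable_const (by fun_prop))
    ((measurable_pi_apply (i, m)) (measurableSet_singleton n))

theorem measure_tail_sum_eq (h : IsModel μ η lam χ) (i n : ℕ) (c : ℝ) :
    μ {ω | c ≤ ∑ j ∈ Finset.range n, η i j ω} = μ {ω | c ≤ ∑ j ∈ Finset.range n, η 0 j ω} := by
  have hi : ∀ i, iIndepFun (fun j => η i j) μ := fun i =>
    h.indep_η.precomp (g := fun j : ℕ => (i, j)) (Prod.mk_right_injective i)
  have hp := IdentDistrib.pi (fun j => (h.ident_η i j).trans (h.ident_η 0 j).symm) (hi i) (hi 0)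
  exact hp.measure_mem_eq (s := {e : ℕ → ℝ | c ≤ ∑ j ∈ Finset.range n, e j})
    (measurableSet_le measurable_const (by fun_prop))

theorem measure_tail_R_eq (h : IsModel μ η lam χ) (i m : ℕ) (c : ℝ) :
    μ {ω | c ≤ R η lam i m ω} = μ {ω | c ≤ R η lam 0 m ω} := by
  rw [h.measure_tail_R, h.measure_tail_R]
  refine tsum_congr fun n => ?_
  rw [h.measure_tail_sum_eq i, (h.ident_lam i m).measure_mem_eq (measurableSet_singleton n)]

theorem indepFun_sum (h : IsModel μ η lam χ) {i i' : ℕ} (hi : i ≠ i') (n n' : ℕ) :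
    IndepFun (fun ω => ∑ j ∈ Finset.range n, η i j ω)
      (fun ω => ∑ j ∈ Finset.range n', η i' j ω) μ := by
  classical
  have hdisj : Disjoint ((Finset.range n).image fun j => (i, j))
      ((Finset.range n').image fun j => (i', j)) := by
    rw [Finset.disjoint_left]
    rintro ⟨a, b⟩ h1 h2
    simp only [Finset.mem_image, Prod.mk.injEq] at h1 h2
    obtain ⟨_, _, rfl, _⟩ := h1
    obtain ⟨_, _, h3, _⟩ := h2
    exact hi h3.symm
  have h0 := h.indep_η.indepFun_finset _ _ hdisj fun p => h.meas_η p.1 p.2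
  have h1 := h0.comp (φ := fun e => ∑ p, e p) (ψ := fun e => ∑ p, e p) (by fun_prop) (by fun_prop)
  convert h1 using 1
  · ext ω
    simp only [Function.comp_apply]
    rw [Finset.sum_coe_sort ((Finset.range n).image fun j => (i, j)) fun p => η p.1 p.2 ω,
      Finset.sum_image (fun a _ b _ hab => (Prod.mk.inj hab).2)]
  · ext ω
    simp only [Function.comp_apply]
    rw [Finset.sum_coe_sort ((Finset.range n').image fun j => (i', j)) fun p => η p.1 p.2 ω,
      Finset.sum_image (fun a _ b _ hab => (Prod.mk.inj hab).2)]

/-- The random sums of two different rows have independent tails. -/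
theorem measure_tail_inter (h : IsModel μ η lam χ) {i i' : ℕ} (hi : i ≠ i') (m : ℕ) (c : ℝ) :
    μ ({ω | c ≤ R η lam i m ω} ∩ {ω | c ≤ R η lam i' m ω}) =
      μ {ω | c ≤ R η lam i m ω} * μ {ω | c ≤ R η lam i' m ω} := by
  have hL : Measurable fun ω => (lam i m ω, lam i' m ω) := (h.meas_lam i m).prodMk (h.meas_lam i' m)
  rw [← tsum_measure_inter_preimage_singleton hL, ENNReal.tsum_prod', h.measure_tail_R i,
    h.measure_tail_R i', ← ENNReal.tsum_mul_right]
  refine tsum_congr fun n => ?_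
  rw [← ENNReal.tsum_mul_left]
  refine tsum_congr fun n' => ?_
  have e : ({ω | c ≤ R η lam i m ω} ∩ {ω | c ≤ R η lam i' m ω}) ∩
      (fun ω => (lam i m ω, lam i' m ω)) ⁻¹' {(n, n')} =
      ({ω | c ≤ ∑ j ∈ Finset.range n, η i j ω} ∩ {ω | c ≤ ∑ j ∈ Finset.range n', η i' j ω}) ∩
      (lam i m ⁻¹' {n} ∩ lam i' m ⁻¹' {n'}) := by
    ext ω
    simp only [Set.mem_inter_iff, Set.mem_ofPred_eq, Set.mem_preimage, Set.mem_singleton_iff, R,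
      Prod.mk.injEq]
    constructor <;> rintro ⟨⟨h1, h2⟩, h3, h4⟩ <;> refine ⟨⟨?_, ?_⟩, h3, h4⟩
    · simpa [h3] using h1
    · simpa [h4] using h2
    · simpa [h3] using h1
    · simpa [h4] using h2
  have h1 : μ (({ω | c ≤ ∑ j ∈ Finset.range n, η i j ω} ∩
        {ω | c ≤ ∑ j ∈ Finset.range n', η i' j ω}) ∩ (lam i m ⁻¹' {n} ∩ lam i' m ⁻¹' {n'})) =
      μ ({ω | c ≤ ∑ j ∈ Finset.range n, η i j ω} ∩ {ω | c ≤ ∑ j ∈ Finset.range n', η i' j ω}) *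
        μ (lam i m ⁻¹' {n} ∩ lam i' m ⁻¹' {n'}) :=
    h.indep.measure_inter_preimage_eq_mul
      ({e : ℕ × ℕ → ℝ | c ≤ ∑ j ∈ Finset.range n, e (i, j)} ∩
        {e : ℕ × ℕ → ℝ | c ≤ ∑ j ∈ Finset.range n', e (i', j)})
      (((fun l : ℕ × ℕ → ℕ => l (i, m)) ⁻¹' {n}) ∩ ((fun l : ℕ × ℕ → ℕ => l (i', m)) ⁻¹' {n'}))
      ((measurableSet_le measurable_const (by fun_prop)).inter
        (measurableSet_le measurable_const (by fun_prop)))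
      (((measurable_pi_apply (i, m)) (measurableSet_singleton n)).inter
        ((measurable_pi_apply (i', m)) (measurableSet_singleton n')))
  have h2 : μ ({ω | c ≤ ∑ j ∈ Finset.range n, η i j ω} ∩
        {ω | c ≤ ∑ j ∈ Finset.range n', η i' j ω}) =
      μ {ω | c ≤ ∑ j ∈ Finset.range n, η i j ω} * μ {ω | c ≤ ∑ j ∈ Finset.range n', η i' j ω} :=
    (h.indepFun_sum hi n n').measure_inter_preimage_eq_mul (Set.Ici c) (Set.Ici c)
      measurableSet_Ici measurableSet_Ici
  have h3 : μ (lam i m ⁻¹' {n} ∩ lam i' m ⁻¹' {n'}) = μ (lam i m ⁻¹' {n}) * μ (lam i' m ⁻¹' {n'}) :=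
    (h.indep_lam.indepFun (i := (i, m)) (j := (i', m)) (by simpa using hi)
      ).measure_inter_preimage_eq_mul _ _ (measurableSet_singleton n) (measurableSet_singleton n')
  rw [e, h1, h2, h3]
  ring

theorem cgf_sum (h : IsModel μ η lam χ) {t : ℝ} (ht : t ∈ expDomain μ (η 0 0)) (n : ℕ) :
    Integrable (fun ω => Real.exp (t * ∑ j ∈ Finset.range n, η 0 j ω)) μ ∧
      cgf (fun ω => ∑ j ∈ Finset.range n, η 0 j ω) μ t = n * cgf (η 0 0) μ t := by
  have hi : iIndepFun (fun j => η 0 j) μ :=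
    h.indep_η.precomp (g := fun j : ℕ => (0, j)) (Prod.mk_right_injective 0)
  have hint : ∀ j, Integrable (fun ω => Real.exp (t * η 0 j ω)) μ := fun j =>
    (((h.ident_η 0 j).comp (u := fun x => Real.exp (t * x)) (by fun_prop)).integrable_iff).2 ht.2
  have e : (fun ω => ∑ j ∈ Finset.range n, η 0 j ω) = ∑ j ∈ Finset.range n, η 0 j := by
    ext ω; simp
  constructor
  · have := hi.integrable_exp_mul_sum (h.meas_η 0) (s := Finset.range n) (t := t)
      (fun j _ => hint j)
    simpa using this
  · rw [e, hi.cgf_sum (h.meas_η 0) (s := Finset.range n) (fun j _ => hint j)]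
    simp [cgf, mgf_congr_of_identDistrib (η 0 _) (η 0 0) (h.ident_η 0 _) t]

/-- Chernoff's bound for the random sums. -/
theorem measureReal_tail_le (h : IsModel μ η lam χ) {x v t : ℝ} (ht : t ∈ expDomain μ (η 0 0))
    (hv : v < x * t - χ (cgf (η 0 0) μ t)) :
    ∀ᶠ m : ℕ in atTop, ∀ i, μ.real {ω | m * x ≤ R η lam i m ω} ≤ Real.exp (-(m * v)) := by
  set s := cgf (η 0 0) μ t
  have hs : 0 ≤ s := h.cgf_nonneg ht
  filter_upwards [h.int_exp_lam s hs, exp_le_mgf_le_of_tendsto (h.int_exp_lam s hs)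
    (h.tendsto_cgf_lam s hs) (sub_pos.2 hv)] with m hm hmgf i
  rw [measureReal_def, h.measure_tail_R_eq i, h.measure_tail_R]
  refine ENNReal.toReal_le_of_le_ofReal (Real.exp_pos _).le ?_
  -- For length `n` Chernoff gives `exp (-m x t + n s)` with `s = cgf t`; summing against the law of
  -- the length produces its moment generating function at `s`.
  calc ∑' n, μ (lam 0 m ⁻¹' {n}) * μ {ω | m * x ≤ ∑ j ∈ Finset.range n, η 0 j ω}
      ≤ ∑' n : ℕ, ENNReal.ofReal (Real.exp (-(m * x * t)) * Real.exp (s * n)) *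
          μ.map (lam 0 m) {n} := by
        refine ENNReal.tsum_le_tsum fun n => ?_
        rw [mul_comm, Measure.map_apply (h.meas_lam 0 m) (measurableSet_singleton n)]
        refine mul_le_mul_left ?_ _
        obtain ⟨hi, hc⟩ := h.cgf_sum ht n
        have h1 := measure_ge_le_exp_cgf (X := fun ω => ∑ j ∈ Finset.range n, η 0 j ω) (m * x)
          ht.1 hi
        rw [hc] at h1
        rw [← ofReal_measureReal, ← Real.exp_add]
        refine ENNReal.ofReal_le_ofReal (h1.trans (le_of_eq ?_))
        congr 1
        simp only [s]; ring
    _ = ∫⁻ ω, ENNReal.ofReal (Real.exp (-(m * x * t)) * Real.exp (s * lam 0 m ω)) ∂μ := by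
        rw [← lintegral_countable', lintegral_map (measurable_of_countable _) (h.meas_lam 0 m)]
    _ = ENNReal.ofReal (Real.exp (-(m * x * t)) * mgf (fun ω => (lam 0 m ω : ℝ)) μ s) := by
        rw [← ofReal_integral_eq_lintegral_ofReal (hm.const_mul _)
          (Eventually.of_forall fun ω => by positivity), integral_const_mul]
        rfl
    _ ≤ ENNReal.ofReal (Real.exp (-(m * v))) := by
        refine ENNReal.ofReal_le_ofReal ?_
        calc _ ≤ Real.exp (-(m * x * t)) * Real.exp (m * (χ s + (x * t - χ s - v))) :=
              mul_le_mul_of_nonneg_left hmgf.2 (Real.exp_pos _).le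
          _ = _ := by rw [← Real.exp_add]; congr 1; ring

/-- Only lengths in `I` are kept in the decomposition by length. It is applied with `I` a window
around `m y₁`. -/
theorem mul_measureReal_le_tail (h : IsModel μ η lam χ) {m : ℕ} {c p : ℝ} (hp : 0 ≤ p) (I : Set ℕ)
    (hI : ∀ n ∈ I, p ≤ μ.real {ω | c ≤ ∑ j ∈ Finset.range n, η 0 j ω}) (i : ℕ) :
    μ.real (lam 0 m ⁻¹' I) * p ≤ μ.real {ω | c ≤ R η lam i m ω} := by
  rw [measureReal_def, measureReal_def, h.measure_tail_R_eq i, ← ENNReal.toReal_ofReal hp,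
    ← ENNReal.toReal_mul]
  refine ENNReal.toReal_mono (measure_ne_top _ _) ?_
  rw [h.measure_tail_R, ← tsum_measure_inter_preimage_singleton (h.meas_lam 0 m),
    ← ENNReal.tsum_mul_right]
  refine ENNReal.tsum_le_tsum fun n => ?_
  by_cases hn : n ∈ I
  · refine mul_le_mul' (measure_mono Set.inter_subset_right) ?_
    rw [← ofReal_measureReal]
    exact ENNReal.ofReal_le_ofReal (hI n hn)
  · have : lam 0 m ⁻¹' I ∩ lam 0 m ⁻¹' {n} = ∅ := by
      ext ω
      simp only [Set.mem_inter_iff, Set.mem_preimage, Set.mem_singleton_iff, Set.mem_empty_iff_false,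
        iff_false, not_and]
      rintro h1 rfl
      exact hn h1
    rw [this, measure_empty, zero_mul]
    exact zero_le

/-- Lower bound for the tails of the random sums. -/
theorem le_measureReal_tail (h : IsModel μ η lam χ) {x x' v ε : ℝ}
    (hv : ∀ t ∈ expDomain μ (η 0 0), x * t - χ (cgf (η 0 0) μ t) ≤ v) (hx : x' < x) (hε : 0 < ε) :
    ∀ᶠ m : ℕ in atTop, ∀ i, Real.exp (-(m * (v + ε))) ≤ μ.real {ω | m * x' ≤ R η lam i m ω} := by
  obtain ⟨t₁, y₁, a₁, B, ht₁, hy₁, hd, hxa, hB, haB, htot⟩ :=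
    exists_tilt zero_mem_expDomain convexOn_cgf_expDomain cgf_zero (fun _ ht => h.cgf_nonneg ht)
      h.convexOn_chi h.monotoneOn_chi h.chi_zero (fun _ ht => h.le_chi ht) h.diff_χ hv hx
      (half_pos hε)
  -- The errors add up to at most `(y₁ + 3) ε'`: one from the law of the length, `y₁ ε'` from the
  -- summands, and `δ B` and `δ ε'`, each at most `ε'`, from the window.
  set ε' := ε / 2 / (y₁ + 3) with hε'
  have hε'0 : 0 < ε' := by positivity
  have hε'e : ε' * (y₁ + 3) = ε / 2 := by rw [hε']; field_simp
  set a' := (a₁ + x' / y₁) / 2 with ha'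
  have hxa' : x' / y₁ < a₁ := by rw [div_lt_iff₀ hy₁]; linarith
  have ha'1 : a' < a₁ := by linarith
  have ha'2 : x' < y₁ * a' := by
    have : x' / y₁ < a' := by linarith
    rw [div_lt_iff₀ hy₁] at this
    linarith
  -- In order, the bounds keep all lengths in the window above `m y₁ / 2`, ensure `n a' ≥ m x'`
  -- there even for negative `a'`, and control `δ ε'` and `δ B`.
  set δ := min (min (y₁ / 2) ((y₁ * a' - x') / (|a'| + 1))) (min 1 (ε' / (B + 1))) with hδ
  have hgap : 0 < y₁ * a' - x' := by linarith
  have hδ0 : 0 < δ := lt_min (lt_min (by positivity) (by positivity))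
    (lt_min one_pos (by positivity))
  have hδ1 : δ ≤ y₁ / 2 := (min_le_left _ _).trans (min_le_left _ _)
  have hδ2 : δ * (|a'| + 1) ≤ y₁ * a' - x' := by
    rw [← le_div_iff₀ (by positivity)]
    exact (min_le_left _ _).trans (min_le_right _ _)
  have hδ3 : δ ≤ 1 := (min_le_right _ _).trans (min_le_left _ _)
  have hδ4 : δ * (B + 1) ≤ ε' := by
    rw [← le_div_iff₀ (by positivity)]
    exact (min_le_right _ _).trans (min_le_right _ _)
  have hpos : ∀ᶠ t in 𝓝 t₁, 0 ≤ t := (lt_mem_nhds ht₁).mono fun _ h => le_of_lt h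
  have hL := exp_le_measureReal_abs_sub_lt (μ := μ) (Z := fun m ω => (lam 0 m ω : ℝ))
    (fun m => measurable_from_top.comp (h.meas_lam 0 m)) hd
    (hpos.mono fun t ht => h.int_exp_lam t ht) (hpos.mono fun t ht => h.tendsto_cgf_lam t ht)
    hδ0 hε'0
  have hi : iIndepFun (fun j => η 0 j) μ :=
    h.indep_η.precomp (g := fun j : ℕ => (0, j)) (Prod.mk_right_injective 0)
  have hS := exp_le_measureReal_sum_ge (h.meas_η 0) hi (h.ident_η 0) h.int_η h.mean_η ha'1 haB hε'0
  obtain ⟨n₀, hn₀⟩ := eventually_atTop.1 hS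
  have hbig : ∀ᶠ m : ℕ in atTop, (n₀ : ℝ) ≤ m * (y₁ / 2) :=
    (tendsto_natCast_atTop_atTop.atTop_mul_const (by positivity)).eventually_ge_atTop _
  filter_upwards [hL, hbig] with m hm hmn i
  have hm0 : (0 : ℝ) ≤ m := Nat.cast_nonneg m
  have hp := h.mul_measureReal_le_tail (m := m) (c := m * x')
    (p := Real.exp (-(m * ((y₁ + δ) * (B + ε'))))) (Real.exp_pos _).le
    {n : ℕ | |(n : ℝ) - m * y₁| < m * δ} (fun n hn => by
      have hn' : |(n : ℝ) - m * y₁| < m * δ := hn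
      obtain ⟨hn1, hn2⟩ := abs_lt.1 hn'
      have hnn : n₀ ≤ n := by
        have : (n₀ : ℝ) ≤ n := by
          have := mul_le_mul_of_nonneg_left hδ1 hm0
          linarith
        exact_mod_cast this
      refine le_trans (Real.exp_le_exp.2 (neg_le_neg ?_)) ((hn₀ n hnn).trans
        (measureReal_mono fun ω (hω : n * a' ≤ ∑ j ∈ Finset.range n, η 0 j ω) =>
          show m * x' ≤ ∑ j ∈ Finset.range n, η 0 j ω from le_trans ?_ hω))
      · rw [← mul_assoc]
        exact mul_le_mul_of_nonneg_right (by linarith) (by linarith)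
      · have h1 : -(m * δ * |a'|) ≤ ((n : ℝ) - m * y₁) * a' := by
          have := neg_abs_le (((n : ℝ) - m * y₁) * a')
          rw [abs_mul] at this
          have := mul_le_mul_of_nonneg_right hn'.le (abs_nonneg a')
          linarith
        have h2 := mul_le_mul_of_nonneg_left hδ2 hm0
        have h3 := mul_nonneg hm0 hδ0.le
        linarith) i
  refine le_trans ?_ hp
  refine le_trans ?_ (mul_le_mul_of_nonneg_right hm (Real.exp_pos _).le)
  rw [← Real.exp_add, Real.exp_le_exp]
  have key : t₁ * y₁ - χ t₁ + ε' + (y₁ + δ) * (B + ε') ≤ v + ε := by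
    have h1 : δ * ε' ≤ 1 * ε' := mul_le_mul_of_nonneg_right hδ3 hε'0.le
    linarith
  have := mul_le_mul_of_nonneg_left key hm0
  linarith

end IsModel

/-! ### Borel–Cantelli and second-moment tools -/

section Counting

variable {μ : Measure Ω} [IsProbabilityMeasure μ]

/-- The Borel–Cantelli lemma for events with exponentially small probabilities. -/
theorem ae_eventually_notMem_of_exp {s : ℕ → Set Ω} {C r : ℝ} (hr : 0 < r)
    (hs : ∀ᶠ m : ℕ in atTop, μ.real (s m) ≤ C * Real.exp (-(m * r))) :
    ∀ᵐ ω ∂μ, ∀ᶠ m in atTop, ω ∉ s m := by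
  refine ae_eventually_notMem ?_
  have hsum : Summable fun m => μ.real (s m) := by
    have hg : Summable fun m : ℕ => C * Real.exp (-(m * r)) := by
      have := (Real.summable_exp_nat_mul_iff (a := -r)).2 (by linarith)
      refine (this.mul_left C).congr fun m => ?_
      rw [mul_neg]
    refine hg.of_norm_bounded_eventually_nat ?_
    filter_upwards [hs] with m hm
    rwa [Real.norm_of_nonneg measureReal_nonneg]
  have e : ∀ m, μ (s m) = ENNReal.ofReal (μ.real (s m)) := fun m => by
    rw [ofReal_measureReal]
  simp_rw [e]
  exact hsum.tsum_ofReal_ne_top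

theorem integral_sum_indicator {A : ℕ → Set Ω} (hA : ∀ i, MeasurableSet (A i)) {p : ℝ}
    (hp : ∀ i, μ.real (A i) = p) (N : ℕ) :
    ∫ ω, ∑ i ∈ Finset.range N, (A i).indicator (fun _ => (1 : ℝ)) ω ∂μ = N * p := by
  rw [integral_finsetSum _ fun i _ => (integrable_const _).indicator (hA i)]
  simp [integral_indicator_const _ (hA _), hp]

theorem memLp_indicator_one {A : Set Ω} (hA : MeasurableSet A) :
    MemLp (A.indicator fun _ => (1 : ℝ)) 2 μ :=
  memLp_indicator_const 2 hA 1 (Or.inr (measure_ne_top _ _))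

theorem covariance_indicator {A B : Set Ω} (hA : MeasurableSet A) (hB : MeasurableSet B) :
    cov[A.indicator fun _ => (1 : ℝ), B.indicator fun _ => (1 : ℝ); μ] =
      μ.real (A ∩ B) - μ.real A * μ.real B := by
  rw [covariance_eq_sub (memLp_indicator_one hA) (memLp_indicator_one hB)]
  have : ((A.indicator fun _ => (1 : ℝ)) * B.indicator fun _ => (1 : ℝ)) =
      (A ∩ B).indicator fun _ => (1 : ℝ) := by
    ext ω
    by_cases h1 : ω ∈ A <;> by_cases h2 : ω ∈ B <;> simp [h1, h2]
  rw [this, integral_indicator_const _ hA, integral_indicator_const _ hB,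
    integral_indicator_const _ (hA.inter hB)]
  simp

/-- Chebyshev's inequality for the number of pairwise independent events that occur. -/
theorem measureReal_sum_indicator_le {A : ℕ → Set Ω} (hA : ∀ i, MeasurableSet (A i)) {p : ℝ}
    (hp : ∀ i, μ.real (A i) = p) (hp0 : 0 < p)
    (hind : ∀ i i', i ≠ i' → μ (A i ∩ A i') = μ (A i) * μ (A i')) {N : ℕ} (hN : 0 < N) :
    μ.real {ω | ∑ i ∈ Finset.range N, (A i).indicator (fun _ => (1 : ℝ)) ω < N * p / 2} ≤
      4 / (N * p) := by
  have hN' : (0 : ℝ) < N := by exact_mod_cast hN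
  set S : Ω → ℝ := fun ω => ∑ i ∈ Finset.range N, (A i).indicator (fun _ => (1 : ℝ)) ω with hS
  have hSm : MemLp S 2 μ := memLp_finsetSum _ fun i _ => memLp_indicator_one (hA i)
  have hmean : μ[S] = N * p := integral_sum_indicator hA hp N
  have hvar : Var[S; μ] ≤ N * p := by
    rw [hS, variance_fun_sum' fun i _ => memLp_indicator_one (hA i)]
    calc _ ≤ ∑ i ∈ Finset.range N, ∑ j ∈ Finset.range N, (if i = j then p else 0) := by
          refine Finset.sum_le_sum fun i _ => Finset.sum_le_sum fun j _ => ?_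
          rw [covariance_indicator (hA i) (hA j)]
          split_ifs with hij
          · subst hij
            rw [Set.inter_self, hp]
            nlinarith
          · simp [measureReal_def, hind i j hij]
      _ = ∑ i ∈ Finset.range N, p := by
          refine Finset.sum_congr rfl fun i hi => ?_
          rw [Finset.sum_ite_eq, if_pos hi]
      _ = N * p := by simp
  have hc : 0 < N * p / 2 := by positivity
  have hch := meas_ge_le_variance_div_sq hSm hc
  rw [hmean] at hch
  have hsub : {ω | S ω < N * p / 2} ⊆ {ω | N * p / 2 ≤ |S ω - N * p|} := by
    intro ω hω
    have hω' : S ω < N * p / 2 := hω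
    change N * p / 2 ≤ |S ω - N * p|
    rw [abs_sub_comm]
    exact le_trans (by linarith) (le_abs_self _)
  refine (measureReal_mono hsub).trans ((ENNReal.toReal_le_of_le_ofReal
    (div_nonneg (variance_nonneg _ _) (sq_nonneg _)) hch).trans ?_)
  rw [div_le_div_iff₀ (by positivity) (by positivity)]
  nlinarith [mul_pos hN' hp0]

theorem exp_div_two_le_floor {x : ℝ} (hx : 0 ≤ x) :
    Real.exp x / 2 ≤ (⌊Real.exp x⌋₊ : ℝ) ∧ 0 < ⌊Real.exp x⌋₊ := by
  have h1 : 1 ≤ Real.exp x := Real.one_le_exp hx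
  have h2 : 1 ≤ ⌊Real.exp x⌋₊ := Nat.one_le_floor_iff _ |>.2 h1
  have h3 : (1 : ℝ) ≤ (⌊Real.exp x⌋₊ : ℝ) := by exact_mod_cast h2
  have h4 := Nat.lt_floor_add_one (Real.exp x)
  exact ⟨by linarith, h2⟩

end Counting

/-! ### Almost sure bounds on the number of large rows -/

/-- The number of indices `i < N` with `m x ≤ R_{i,m}`. -/
noncomputable def tailCount (η : ℕ → ℕ → Ω → ℝ) (lam : ℕ → ℕ → Ω → ℕ) (N m : ℕ) (x : ℝ) (ω : Ω) : ℝ :=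
  ∑ i ∈ Finset.range N, {ω | m * x ≤ R η lam i m ω}.indicator (fun _ => (1 : ℝ)) ω

namespace IsModel

variable {μ : Measure Ω} [IsProbabilityMeasure μ] {η : ℕ → ℕ → Ω → ℝ} {lam : ℕ → ℕ → Ω → ℕ}
  {χ : ℝ → ℝ}

/-- Union bound: `e^{qm}` rows, each exceeding the level with probability at most `e^{-mv}` for some
`v > q`, which is summable. -/
theorem ae_eventually_R_lt (h : IsModel μ η lam χ) {x q t : ℝ}
    (ht : t ∈ expDomain μ (η 0 0)) (hq : q < x * t - χ (cgf (η 0 0) μ t)) :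
    ∀ᵐ ω ∂μ, ∀ᶠ m : ℕ in atTop, ∀ i < ⌊Real.exp (q * m)⌋₊, R η lam i m ω < m * x := by
  obtain ⟨v, hqv, hv⟩ := exists_between hq
  have := ae_eventually_notMem_of_exp (μ := μ) (C := 1) (sub_pos.2 hqv)
    (s := fun m : ℕ => ⋃ i ∈ Finset.range ⌊Real.exp (q * m)⌋₊, {ω | m * x ≤ R η lam i m ω}) (by
      filter_upwards [h.measureReal_tail_le ht hv] with m hm
      refine (measureReal_biUnion_finset_le _ _).trans
        ((Finset.sum_le_sum fun i _ => hm i).trans ?_)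
      rw [Finset.sum_const, Finset.card_range, nsmul_eq_mul, one_mul]
      calc _ ≤ Real.exp (q * m) * Real.exp (-(m * v)) :=
            mul_le_mul_of_nonneg_right (Nat.floor_le (Real.exp_pos _).le) (Real.exp_pos _).le
        _ = _ := by rw [← Real.exp_add]; congr 1; ring)
  filter_upwards [this] with ω hω
  filter_upwards [hω] with m hm i hi
  by_contra hcon
  exact hm (Set.mem_biUnion (Finset.mem_coe.2 (Finset.mem_range.2 hi)) (not_lt.1 hcon))

/-- Markov's inequality at a rate `w` strictly below the true exponent leaves a summable probability
`e^{-m(v-w)}`. -/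
theorem ae_eventually_tailCount_le (h : IsModel μ η lam χ) {x w t : ℝ} (N : ℕ → ℕ)
    (ht : t ∈ expDomain μ (η 0 0)) (hw : w < x * t - χ (cgf (η 0 0) μ t)) :
    ∀ᵐ ω ∂μ, ∀ᶠ m : ℕ in atTop, tailCount η lam (N m) m x ω ≤ N m * Real.exp (-(m * w)) := by
  obtain ⟨v, hwv, hv⟩ := exists_between hw
  have := ae_eventually_notMem_of_exp (μ := μ) (C := 1) (sub_pos.2 hwv)
    (s := fun m : ℕ => {ω | N m * Real.exp (-(m * w)) < tailCount η lam (N m) m x ω}) (by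
      filter_upwards [h.measureReal_tail_le ht hv] with m hm
      rcases Nat.eq_zero_or_pos (N m) with h0 | hpos
      · simp [tailCount, h0, Real.exp_nonneg]
      have hN : (0 : ℝ) < N m := by exact_mod_cast hpos
      have hA := fun i => h.measurableSet_tail i m (m * x)
      have hp : ∀ i, μ.real {ω | m * x ≤ R η lam i m ω} = μ.real {ω | m * x ≤ R η lam 0 m ω} :=
        fun i => by rw [measureReal_def, h.measure_tail_R_eq i]; rfl
      have hint := integral_sum_indicator hA hp (N m)
      have hmk := mul_meas_ge_le_integral_of_nonneg (μ := μ) (f := tailCount η lam (N m) m x)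
        (Eventually.of_forall fun ω => Finset.sum_nonneg fun i _ =>
          Set.indicator_nonneg (fun _ _ => zero_le_one) _)
        (integrable_finsetSum _ fun i _ => (integrable_const _).indicator (hA i))
        (N m * Real.exp (-(m * w)))
      have h1 : N m * Real.exp (-(m * w)) *
          μ.real {ω | N m * Real.exp (-(m * w)) < tailCount η lam (N m) m x ω} ≤
          N m * Real.exp (-(m * v)) := by
        have hmono : μ.real {ω | N m * Real.exp (-(m * w)) < tailCount η lam (N m) m x ω} ≤
            μ.real {ω | N m * Real.exp (-(m * w)) ≤ tailCount η lam (N m) m x ω} :=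
          measureReal_mono (by
            intro ω hω
            simp only [Set.mem_ofPred_eq] at hω ⊢
            exact hω.le)
        calc _ ≤ _ := mul_le_mul_of_nonneg_left hmono (by positivity)
          _ ≤ _ := hmk
          _ = _ := hint
          _ ≤ _ := mul_le_mul_of_nonneg_left (hm 0) hN.le
      rw [mul_assoc, mul_le_mul_iff_right₀ hN, mul_comm, ← le_div_iff₀ (Real.exp_pos _),
        ← Real.exp_sub] at h1
      refine h1.trans (le_of_eq ?_)
      rw [one_mul]; congr 1; ring)
  filter_upwards [this] with ω hω
  filter_upwards [hω] with m hm
  exact not_lt.1 hm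

theorem ae_eventually_le_tailCount (h : IsModel μ η lam χ) {x x' v q ε : ℝ} (hq : 0 < q)
    (hv : ∀ t ∈ expDomain μ (η 0 0), x * t - χ (cgf (η 0 0) μ t) ≤ v) (hx : x' < x) (hε : 0 < ε)
    (hvq : v < q) :
    ∀ᵐ ω ∂μ, ∀ᶠ m : ℕ in atTop, ⌊Real.exp (q * m)⌋₊ * Real.exp (-(m * (v + ε))) ≤
      tailCount η lam ⌊Real.exp (q * m)⌋₊ m x' ω := by
  -- The cap `(q - v) / 2` keeps the expected count exponentially large, so Chebyshev's bound is
  -- summable; its constant 8 is 4 times the 2 lost in the floor. The cap `ε / 2` leaves room to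
  -- absorb the halving of the count.
  set ε' := min (ε / 2) ((q - v) / 2) with hε'
  have hε'0 : 0 < ε' := lt_min (by positivity) (by linarith)
  have hε'1 : ε' ≤ ε / 2 := min_le_left _ _
  have hε'2 : ε' ≤ (q - v) / 2 := min_le_right _ _
  have hr : 0 < q - v - ε' := by linarith
  have := ae_eventually_notMem_of_exp (μ := μ) (C := 8) hr
    (s := fun m : ℕ => {ω | tailCount η lam ⌊Real.exp (q * m)⌋₊ m x' ω <
      ⌊Real.exp (q * m)⌋₊ * μ.real {ω | m * x' ≤ R η lam 0 m ω} / 2}) (by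
      filter_upwards [h.le_measureReal_tail hv hx hε'0] with m hm
      obtain ⟨hN, hN0⟩ := exp_div_two_le_floor (x := q * m) (by positivity)
      have hp0 : 0 < μ.real {ω | m * x' ≤ R η lam 0 m ω} := (Real.exp_pos _).trans_le (hm 0)
      have hNpos : (0 : ℝ) < ⌊Real.exp (q * m)⌋₊ := by exact_mod_cast hN0
      refine (measureReal_sum_indicator_le (fun i => h.measurableSet_tail i m (m * x'))
        (fun i => by rw [measureReal_def, h.measure_tail_R_eq i]; rfl) hp0
        (fun i i' hi => h.measure_tail_inter hi m _) hN0).trans ?_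
      rw [div_le_iff₀ (by positivity)]
      have h1 : Real.exp (q * m) / 2 * Real.exp (-(m * (v + ε'))) ≤
          ⌊Real.exp (q * m)⌋₊ * μ.real {ω | m * x' ≤ R η lam 0 m ω} :=
        mul_le_mul hN (hm 0) (Real.exp_pos _).le hNpos.le
      have h2 := mul_le_mul_of_nonneg_left h1
        (show 0 ≤ 8 * Real.exp (-(m * (q - v - ε'))) by positivity)
      refine le_trans (le_of_eq ?_) h2
      have h3 : Real.exp (-(m * (q - v - ε'))) * (Real.exp (q * m) * Real.exp (-(m * (v + ε')))) = 1 := by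
        rw [← Real.exp_add, ← Real.exp_add, Real.exp_eq_one_iff]; ring
      linarith)
  have hbig : ∀ᶠ m : ℕ in atTop, Real.log 2 ≤ m * (ε / 2) :=
    (tendsto_natCast_atTop_atTop.atTop_mul_const (by positivity)).eventually_ge_atTop _
  filter_upwards [this] with ω hω
  filter_upwards [hω, h.le_measureReal_tail hv hx hε'0, hbig] with m hm hp hb
  refine le_trans ?_ (not_lt.1 hm)
  rw [mul_div_assoc]
  refine mul_le_mul_of_nonneg_left ?_ (Nat.cast_nonneg _)
  rw [le_div_iff₀ two_pos]
  refine le_trans ?_ (hp 0)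
  rw [← Real.exp_log (show (0 : ℝ) < 2 by norm_num), ← Real.exp_add, Real.exp_le_exp]
  have := mul_le_mul_of_nonneg_left hε'1 (Nat.cast_nonneg (α := ℝ) m)
  linarith

end IsModel

/-! ### From counts to `log Y` -/

section Deterministic

variable {η : ℕ → ℕ → Ω → ℝ} {lam : ℕ → ℕ → Ω → ℕ} {β k : ℝ} {N m : ℕ} {ω : Ω}

theorem log_Y (hN : 0 < N) : Real.log (Y η lam β N m k ω) =
    1 / k * Real.log ((∑ i ∈ Finset.range N, Real.exp (β * R η lam i m ω * (k / m))) / N) := by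
  have hN' : (0 : ℝ) < N := by exact_mod_cast hN
  have hpos : 0 < ∑ i ∈ Finset.range N, Real.exp (β * R η lam i m ω * (k / m)) :=
    Finset.sum_pos (fun i _ => Real.exp_pos _) ⟨0, Finset.mem_range.2 hN⟩
  simp only [Y, ← Real.exp_mul]
  rw [Real.log_rpow (by positivity), one_div_mul_eq_div (N : ℝ)]

/-- Only the rows above level `m x` are kept; they are a fraction at least `e^{-mw}` of all rows,
each contributing at least `e^{β x k}`. -/
theorem le_log_Y (hβ : 0 ≤ β) (hm : 0 < m) (hk : 0 < k) (hN : 0 < N) {x w : ℝ}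
    (h : N * Real.exp (-(m * w)) ≤ tailCount η lam N m x ω) :
    β * x - w / (k / m) ≤ Real.log (Y η lam β N m k ω) := by
  have hN' : (0 : ℝ) < N := by exact_mod_cast hN
  have hm' : (0 : ℝ) < m := by exact_mod_cast hm
  have hkm : 0 < k / m := by positivity
  have hS : tailCount η lam N m x ω * Real.exp (β * (m * x) * (k / m)) ≤
      ∑ i ∈ Finset.range N, Real.exp (β * R η lam i m ω * (k / m)) := by
    rw [tailCount, Finset.sum_mul]
    refine Finset.sum_le_sum fun i _ => ?_
    by_cases hi : m * x ≤ R η lam i m ω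
    · rw [Set.indicator_of_mem (show ω ∈ {ω | m * x ≤ R η lam i m ω} from hi), one_mul]
      exact Real.exp_le_exp.2 (mul_le_mul_of_nonneg_right (mul_le_mul_of_nonneg_left hi hβ) hkm.le)
    · rw [Set.indicator_of_notMem (show ω ∉ {ω | m * x ≤ R η lam i m ω} from hi), zero_mul]
      exact (Real.exp_pos _).le
  have h1 : Real.exp (-(m * w) + β * (m * x) * (k / m)) ≤
      (∑ i ∈ Finset.range N, Real.exp (β * R η lam i m ω * (k / m))) / N := by
    rw [le_div_iff₀ hN', Real.exp_add]
    calc _ = N * Real.exp (-(m * w)) * Real.exp (β * (m * x) * (k / m)) := by ring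
      _ ≤ _ := mul_le_mul_of_nonneg_right h (Real.exp_pos _).le
      _ ≤ _ := hS
  have h2 := Real.log_le_log (Real.exp_pos _) h1
  rw [Real.log_exp] at h2
  rw [log_Y hN]
  calc β * x - w / (k / m) = 1 / k * (-(m * w) + β * (m * x) * (k / m)) := by
        field_simp
        ring
    _ ≤ _ := mul_le_mul_of_nonneg_left h2 (by positivity)

theorem log_Y_le_of_sum_le (hm : 0 < m) (hk : 0 < k) (hN : 0 < N) {C U : ℝ} (hC : 0 < C)
    (h : ∑ i ∈ Finset.range N, Real.exp (β * R η lam i m ω * (k / m)) ≤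
      N * (C * Real.exp (m * U))) :
    Real.log (Y η lam β N m k ω) ≤ Real.log C / k + U / (k / m) := by
  have hN' : (0 : ℝ) < N := by exact_mod_cast hN
  have hm' : (0 : ℝ) < m := by exact_mod_cast hm
  have hpos : 0 < ∑ i ∈ Finset.range N, Real.exp (β * R η lam i m ω * (k / m)) :=
    Finset.sum_pos (fun i _ => Real.exp_pos _) ⟨0, Finset.mem_range.2 hN⟩
  have h1 : (∑ i ∈ Finset.range N, Real.exp (β * R η lam i m ω * (k / m))) / N ≤
      C * Real.exp (m * U) := by
    rw [div_le_iff₀ hN']; linarith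
  have h2 := Real.log_le_log (by positivity) h1
  rw [Real.log_mul hC.ne' (Real.exp_pos _).ne', Real.log_exp] at h2
  rw [log_Y hN]
  calc _ ≤ 1 / k * (Real.log C + m * U) := mul_le_mul_of_nonneg_left h2 (by positivity)
    _ = _ := by field_simp

theorem log_Y_le_of_lt (hβ : 0 ≤ β) (hm : 0 < m) (hk : 0 < k) (hN : 0 < N) {x : ℝ}
    (h : ∀ i < N, R η lam i m ω < m * x) : Real.log (Y η lam β N m k ω) ≤ β * x := by
  have hm' : (0 : ℝ) < m := by exact_mod_cast hm
  have h1 := log_Y_le_of_sum_le (η := η) (lam := lam) (β := β) (ω := ω) hm hk hN one_pos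
    (U := β * x * (k / m)) (by
      calc _ ≤ ∑ i ∈ Finset.range N, 1 * Real.exp (m * (β * x * (k / m))) := by
            refine Finset.sum_le_sum fun i hi => ?_
            rw [one_mul, Real.exp_le_exp]
            have := mul_le_mul_of_nonneg_right (mul_le_mul_of_nonneg_left
              (h i (Finset.mem_range.1 hi)).le hβ) (show 0 ≤ k / m by positivity)
            linarith
        _ = _ := by simp)
  rw [Real.log_one, zero_div, zero_add, mul_div_assoc, div_self (by positivity), mul_one] at h1
  exact h1

/-- Upper bound for `log Y` by means of the counting function on the grid `{j d : j < J}`. -/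
theorem log_Y_le_of_grid (hβ : 0 ≤ β) (hm : 0 < m) (hk : 0 < k) (hN : 0 < N) {d U : ℝ} (hd : 0 < d)
    {J : ℕ} {w : ℕ → ℝ} (hU : 0 ≤ U)
    (hR : ∀ i < N, R η lam i m ω < m * (J * d))
    (hcount : ∀ j < J, tailCount η lam N m (j * d) ω ≤ N * Real.exp (-(m * w j)))
    (hw : ∀ j < J, β * ((j + 1) * d) * (k / m) - w j ≤ U) :
    Real.log (Y η lam β N m k ω) ≤ Real.log (1 + J) / k + U / (k / m) := by
  have hm' : (0 : ℝ) < m := by exact_mod_cast hm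
  have hkm : 0 < k / m := by positivity
  refine log_Y_le_of_sum_le hm hk hN (by positivity) ?_
  set E : ℕ → ℝ := fun j => Real.exp (β * (m * ((j + 1) * d)) * (k / m)) with hE
  have hpt : ∀ i ∈ Finset.range N, Real.exp (β * R η lam i m ω * (k / m)) ≤
      1 + ∑ j ∈ Finset.range J,
        {ω | m * (j * d) ≤ R η lam i m ω}.indicator (fun _ => (1 : ℝ)) ω * E j := by
    intro i hi
    have hterm : ∀ j ∈ Finset.range J,
        0 ≤ {ω | m * (j * d) ≤ R η lam i m ω}.indicator (fun _ => (1 : ℝ)) ω * E j := fun j _ =>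
      mul_nonneg (Set.indicator_nonneg (fun _ _ => zero_le_one) _) (Real.exp_pos _).le
    -- A negative row contributes at most 1, absorbed later through `1 ≤ exp (m U)`. Otherwise the
    -- row is counted at the left end of its cell and bounded by the exponential at the right end.
    rcases lt_or_ge (R η lam i m ω) 0 with hneg | hpos
    · have : Real.exp (β * R η lam i m ω * (k / m)) ≤ 1 := by
        rw [Real.exp_le_one_iff]
        exact mul_nonpos_of_nonpos_of_nonneg (mul_nonpos_of_nonneg_of_nonpos hβ hneg.le) hkm.le
      linarith [Finset.sum_nonneg hterm]
    · set j := ⌊R η lam i m ω / (m * d)⌋₊ with hj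
      have hmd : 0 < m * d := by positivity
      have h1 : (j : ℝ) * (m * d) ≤ R η lam i m ω := by
        rw [← le_div_iff₀ hmd]; exact Nat.floor_le (by positivity)
      have h2 : R η lam i m ω < (j + 1) * (m * d) := by
        rw [← div_lt_iff₀ hmd]; exact Nat.lt_floor_add_one _
      have hjJ : j < J := by
        have h3 := hR i (Finset.mem_range.1 hi)
        have : (j : ℝ) < J := by
          by_contra hcon
          have := mul_le_mul_of_nonneg_right (not_lt.1 hcon) hmd.le
          linarith
        exact_mod_cast this
      have h4 := Finset.single_le_sum hterm (Finset.mem_range.2 hjJ)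
      rw [Set.indicator_of_mem (show ω ∈ {ω | m * (j * d) ≤ R η lam i m ω} from by
        change m * (j * d) ≤ R η lam i m ω
        linarith), one_mul] at h4
      have h5 : Real.exp (β * R η lam i m ω * (k / m)) ≤ E j := by
        rw [hE, Real.exp_le_exp]
        refine mul_le_mul_of_nonneg_right (mul_le_mul_of_nonneg_left ?_ hβ) hkm.le
        linarith
      linarith
  refine (Finset.sum_le_sum hpt).trans ?_
  rw [Finset.sum_add_distrib, Finset.sum_comm]
  have hcells : ∑ j ∈ Finset.range J, ∑ i ∈ Finset.range N,
      {ω | m * (j * d) ≤ R η lam i m ω}.indicator (fun _ => (1 : ℝ)) ω * E j ≤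
      ∑ j ∈ Finset.range J, N * Real.exp (m * U) := by
    refine Finset.sum_le_sum fun j hj => ?_
    have hj' := Finset.mem_range.1 hj
    rw [← Finset.sum_mul]
    calc _ ≤ N * Real.exp (-(m * w j)) * E j :=
          mul_le_mul_of_nonneg_right (hcount j hj') (Real.exp_pos _).le
      _ = N * Real.exp (m * (β * ((j + 1) * d) * (k / m) - w j)) := by
          rw [mul_assoc, hE, ← Real.exp_add]; congr 2; ring
      _ ≤ _ := mul_le_mul_of_nonneg_left (Real.exp_le_exp.2
          (mul_le_mul_of_nonneg_left (hw j hj') hm'.le)) (Nat.cast_nonneg _)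
  have hone : (1 : ℝ) ≤ Real.exp (m * U) := Real.one_le_exp (by positivity)
  have hN0 : (0 : ℝ) ≤ N := Nat.cast_nonneg _
  calc _ ≤ N * Real.exp (m * U) + ∑ j ∈ Finset.range J, N * Real.exp (m * U) := by
        refine add_le_add ?_ hcells
        rw [Finset.sum_const, Finset.card_range, nsmul_eq_mul]
        exact mul_le_mul_of_nonneg_left hone hN0
    _ = _ := by
        rw [Finset.sum_const, Finset.card_range, nsmul_eq_mul]; ring

end Deterministic

/-- The exceptional null set may depend on `e`, so only the countably many values `1 / (n + 1)` are
used. -/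
theorem ae_tendsto_of_le {μ : Measure Ω} {f : ℕ → Ω → ℝ} {l : ℝ}
    (hup : ∀ e : ℝ, 0 < e → ∀ᵐ ω ∂μ, ∀ᶠ m in atTop, f m ω ≤ l + e)
    (hlow : ∀ e : ℝ, 0 < e → ∀ᵐ ω ∂μ, ∀ᶠ m in atTop, l - e ≤ f m ω) :
    ∀ᵐ ω ∂μ, Tendsto (fun m => f m ω) atTop (𝓝 l) := by
  have h1 : ∀ᵐ ω ∂μ, ∀ n : ℕ, ∀ᶠ m in atTop, f m ω ≤ l + 1 / ((n : ℝ) + 1) :=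
    ae_all_iff.2 fun n => hup _ (by positivity)
  have h2 : ∀ᵐ ω ∂μ, ∀ n : ℕ, ∀ᶠ m in atTop, l - 1 / ((n : ℝ) + 1) ≤ f m ω :=
    ae_all_iff.2 fun n => hlow _ (by positivity)
  filter_upwards [h1, h2] with ω hω1 hω2
  rw [Metric.tendsto_nhds]
  intro e he
  obtain ⟨n, hn⟩ := exists_nat_one_div_lt he
  filter_upwards [hω1 n, hω2 n] with m hm1 hm2
  rw [Real.dist_eq, abs_lt]
  constructor <;> linarith

/-! ### Shape of the rate function -/

namespace IsModel

variable {μ : Measure Ω} [IsProbabilityMeasure μ] {η : ℕ → ℕ → Ω → ℝ} {lam : ℕ → ℕ → Ω → ℕ}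
  {χ : ℝ → ℝ} {ν : ℝ → EReal} {q : ℝ}

theorem nu_nonneg (h : IsModel μ η lam χ) (hν : ν = nu (cramer μ (η 0 0)) (legendre χ)) (x : ℝ) :
    0 ≤ ν x := by
  by_contra hcon
  obtain ⟨r, hr1, hr2⟩ := EReal.lt_iff_exists_real_btwn.1 (not_le.1 hcon)
  rw [hν] at hr1
  have := h.nu_le_iff.1 hr1.le 0 zero_mem_expDomain
  rw [cgf_zero, h.chi_zero, mul_zero, sub_zero] at this
  have h2 : r < 0 := by exact_mod_cast hr2
  linarith

theorem coe_toReal_nu (h : IsModel μ η lam χ) (hν : ν = nu (cramer μ (η 0 0)) (legendre χ)) {x : ℝ}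
    (hx : ν x < ⊤) : ((ν x).toReal : EReal) = ν x :=
  EReal.coe_toReal hx.ne (ne_bot_of_le_ne_bot (by simp) (h.nu_nonneg hν x))

theorem toReal_nu_nonneg (h : IsModel μ η lam χ) (hν : ν = nu (cramer μ (η 0 0)) (legendre χ))
    (x : ℝ) : 0 ≤ (ν x).toReal :=
  EReal.toReal_nonneg (h.nu_nonneg hν x)

theorem nu_of_nonpos (h : IsModel μ η lam χ) (hν : ν = nu (cramer μ (η 0 0)) (legendre χ)) {x : ℝ}
    (hx : x ≤ 0) : ν x = 0 := by
  refine le_antisymm ?_ (h.nu_nonneg hν x)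
  rw [hν, ← EReal.coe_zero]
  refine h.nu_le_iff.2 fun t ht => ?_
  have h1 := h.cgf_nonneg ht
  have h2 := h.le_chi h1
  have h3 := mul_nonpos_of_nonpos_of_nonneg hx ht.1
  linarith

theorem bddAbove_nu_le (h : IsModel μ η lam χ) (hν : ν = nu (cramer μ (η 0 0)) (legendre χ)) :
    BddAbove {x : ℝ | ν x ≤ (q : EReal)} := by
  obtain ⟨t, ht, hi⟩ := h.exp_η
  refine ⟨(q + χ (cgf (η 0 0) μ t)) / t, fun x (hx : ν x ≤ q) => ?_⟩
  rw [hν] at hx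
  have := h.nu_le_iff.1 hx t ⟨ht.le, hi⟩
  rw [le_div_iff₀ ht]
  linarith

/-- The sublevel set `{ν ≤ q}` has a largest element. -/
theorem isGreatest_nu_le (h : IsModel μ η lam χ) (hν : ν = nu (cramer μ (η 0 0)) (legendre χ))
    (hq : 0 < q) : IsGreatest {x : ℝ | ν x ≤ (q : EReal)} (sSup {x : ℝ | ν x ≤ (q : EReal)}) := by
  have h0 : (0 : ℝ) ∈ {x : ℝ | ν x ≤ (q : EReal)} := by
    change ν 0 ≤ q
    rw [h.nu_of_nonpos hν le_rfl]
    exact_mod_cast hq.le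
  refine ⟨?_, fun x hx => le_csSup (h.bddAbove_nu_le hν) hx⟩
  change ν _ ≤ (q : EReal)
  rw [hν]
  refine h.nu_le_iff.2 fun t ht => ?_
  -- Each `t > 0` in the domain defines a closed half-line, and the sublevel set is their
  -- intersection; `t = 0` only asks for `0 ≤ q`.
  rcases ht.1.eq_or_lt with rfl | htpos
  · rw [cgf_zero, h.chi_zero]
    linarith
  · have : sSup {x : ℝ | ν x ≤ (q : EReal)} ≤ (q + χ (cgf (η 0 0) μ t)) / t := by
      refine csSup_le ⟨0, h0⟩ fun x (hx : ν x ≤ q) => ?_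
      rw [hν] at hx
      have := h.nu_le_iff.1 hx t ht
      rw [le_div_iff₀ htpos]
      linarith
    rw [le_div_iff₀ htpos] at this
    rw [← hν]
    linarith

theorem nu_mono (h : IsModel μ η lam χ) (hν : ν = nu (cramer μ (η 0 0)) (legendre χ)) :
    Monotone ν := by
  intro x y hxy
  rcases eq_or_ne (ν y) ⊤ with htop | hne
  · rw [htop]; exact le_top
  have hy := h.coe_toReal_nu hν hne.lt_top
  rw [← hy]
  have hle : nu (cramer μ (η 0 0)) (legendre χ) y ≤ ((ν y).toReal : EReal) := by rw [hy, hν]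
  rw [hν] at hle ⊢
  refine h.nu_le_iff.2 fun t ht => ?_
  have h1 := h.nu_le_iff.1 hle t ht
  have h2 := mul_le_mul_of_nonneg_right hxy ht.1
  linarith

/-- Convexity of the rate function. -/
theorem nu_convex (h : IsModel μ η lam χ) (hν : ν = nu (cramer μ (η 0 0)) (legendre χ))
    {x y u v s : ℝ} (hx : ν x ≤ u) (hy : ν y ≤ v) (hs0 : 0 ≤ s) (hs1 : s ≤ 1) :
    ν ((1 - s) * x + s * y) ≤ (((1 - s) * u + s * v : ℝ) : EReal) := by
  rw [hν] at hx hy ⊢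
  refine h.nu_le_iff.2 fun t ht => ?_
  have h1 := mul_le_mul_of_nonneg_left (h.nu_le_iff.1 hx t ht) (sub_nonneg.2 hs1)
  have h2 := mul_le_mul_of_nonneg_left (h.nu_le_iff.1 hy t ht) hs0
  linarith

/-- Uniqueness of the solution of `ν x = q`. -/
theorem nu_eq_iff (h : IsModel μ η lam χ) (hν : ν = nu (cramer μ (η 0 0)) (legendre χ))
    (hq : 0 < q) {γ : ℝ} (hγ : IsGreatest {x : ℝ | ν x ≤ (q : EReal)} γ)
    (hex : ∃ x : ℝ, (q : EReal) ≤ ν x ∧ ν x < ⊤) (x : ℝ) : ν x = (q : EReal) ↔ x = γ := by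
  have hγq : ν γ ≤ q := hγ.1
  constructor
  · intro hx
    have hxγ : x ≤ γ := hγ.2 (le_of_eq hx)
    by_contra hne
    have hlt : x < γ := lt_of_le_of_ne hxγ hne
    have hx0 : 0 < x := by
      by_contra hcon
      rw [h.nu_of_nonpos hν (not_lt.1 hcon)] at hx
      have : (0 : ℝ) = q := by exact_mod_cast hx
      linarith
    have hγ0 : 0 < γ := hx0.trans hlt
    have h0 : ν 0 ≤ ((0 : ℝ) : EReal) := by rw [h.nu_of_nonpos hν le_rfl]; simp
    -- Along the chord from 0, where `ν` vanishes, convexity gives `ν x ≤ (x / γ) q < q`.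
    have h1 := h.nu_convex hν h0 hγq (s := x / γ) (by positivity) ((div_le_one hγ0).2 hxγ)
    have e : (1 - x / γ) * 0 + x / γ * γ = x := by field_simp; ring
    rw [e, hx, EReal.coe_le_coe_iff] at h1
    have h2 : x / γ < 1 := (div_lt_one hγ0).2 hlt
    nlinarith
  · rintro rfl
    refine le_antisymm hγq ?_
    by_contra hcon
    obtain ⟨y, hy1, hy2⟩ := hex
    have hxlt : ν x < q := not_le.1 hcon
    have hxy : x < y := by
      by_contra hle
      exact absurd (hy1.trans (h.nu_mono hν (not_lt.1 hle))) hcon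
    have hcx := h.coe_toReal_nu hν (hxlt.trans (EReal.coe_lt_top _))
    have hcy := h.coe_toReal_nu hν hy2
    set u := (ν x).toReal
    set v := (ν y).toReal
    have huq : u < q := by rw [← hcx] at hxlt; exact_mod_cast hxlt
    have hqv : q ≤ v := by rw [← hcy] at hy1; exact_mod_cast hy1
    have huv : 0 < v - u := by linarith
    have hs0 : 0 < (q - u) / (v - u) := div_pos (by linarith) huv
    -- At this parameter the chord from the greatest element of the sublevel set to `y` has height
    -- `q`, which puts a larger point into that set.
    have h1 := h.nu_convex hν hcx.ge hcy.ge (s := (q - u) / (v - u)) hs0.le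
      ((div_le_one huv).2 (by linarith))
    have e : (1 - (q - u) / (v - u)) * u + (q - u) / (v - u) * v = q := by
      field_simp
      ring
    rw [e] at h1
    have h2 := hγ.2 h1
    have h3 := mul_pos hs0 (sub_pos.2 hxy)
    linarith

/-! ### The two limiting regimes -/

theorem exists_of_lt_nu (h : IsModel μ η lam χ) (hν : ν = nu (cramer μ (η 0 0)) (legendre χ))
    {x w : ℝ} (hw : (w : EReal) < ν x) :
    ∃ t ∈ expDomain μ (η 0 0), w < x * t - χ (cgf (η 0 0) μ t) := by
  by_contra! hcon
  have := h.nu_le_iff.2 hcon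
  rw [← hν] at this
  exact absurd hw (not_lt.2 this)

/-- The second-moment bound needs a rate strictly below `q`. Moving `x` slightly towards 0 lowers
the rate to `(1 - s) v < q` by convexity, so the boundary case `v = q` is covered. -/
theorem ae_tailCount_ge (h : IsModel μ η lam χ) (hν : ν = nu (cramer μ (η 0 0)) (legendre χ))
    (hq : 0 < q) {x v e : ℝ} (hv : ν x ≤ v) (hvq : v ≤ q) (he : 0 < e) :
    ∃ x', x - e ≤ x' ∧ ∀ᵐ ω ∂μ, ∀ᶠ m : ℕ in atTop,
      ⌊Real.exp (q * m)⌋₊ * Real.exp (-(m * (v + e))) ≤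
        tailCount η lam ⌊Real.exp (q * m)⌋₊ m x' ω := by
  set s := min (1 / 2) (e / (2 * (|x| + 1))) with hs
  have hs0 : 0 < s := lt_min (by norm_num) (by positivity)
  have hs1 : s ≤ 1 / 2 := min_le_left _ _
  have hs2 : s * (2 * (|x| + 1)) ≤ e := by
    rw [← le_div_iff₀ (by positivity)]; exact min_le_right _ _
  have hv0 : 0 ≤ v := by
    have := (h.nu_nonneg hν x).trans hv
    exact_mod_cast this
  have h0 : ν 0 ≤ ((0 : ℝ) : EReal) := by rw [h.nu_of_nonpos hν le_rfl]; simp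
  have h1 := h.nu_convex hν hv h0 hs0.le (by linarith)
  simp only [mul_zero, add_zero] at h1
  rw [hν] at h1
  have hlt : (1 - s) * v < q := by
    rcases hv0.eq_or_lt with rfl | hpos
    · linarith
    · nlinarith
  refine ⟨(1 - s) * x - e / 2, ?_, ?_⟩
  · have h2 := mul_le_mul_of_nonneg_left (le_abs_self x) hs0.le
    linarith
  · filter_upwards [h.ae_eventually_le_tailCount hq (h.nu_le_iff.1 h1)
      (show (1 - s) * x - e / 2 < (1 - s) * x by linarith) he hlt] with ω hω
    filter_upwards [hω] with m hm
    refine le_trans (mul_le_mul_of_nonneg_left (Real.exp_le_exp.2 (neg_le_neg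
      (mul_le_mul_of_nonneg_left ?_ (Nat.cast_nonneg m)))) (Nat.cast_nonneg _)) hm
    have := mul_nonneg hs0.le hv0
    linarith

theorem floor_exp_pos (hq : 0 < q) (m : ℕ) : 0 < ⌊Real.exp (q * m)⌋₊ :=
  (exp_div_two_le_floor (by positivity)).2

/-- The regime `k ≫ m`. -/
theorem ae_tendsto_log_Y_of_tendsto_atTop (h : IsModel μ η lam χ)
    (hν : ν = nu (cramer μ (η 0 0)) (legendre χ)) {β : ℝ} (hβ : 0 < β) (hq : 0 < q) {γ : ℝ}
    (hγ : IsGreatest {x : ℝ | ν x ≤ (q : EReal)} γ) {k : ℕ → ℝ}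
    (hk : Tendsto (fun m : ℕ => k m / (m : ℝ)) atTop atTop) :
    ∀ᵐ ω ∂μ, Tendsto (fun m : ℕ => Real.log (Y η lam β ⌊Real.exp (q * m)⌋₊ m (k m) ω))
      atTop (𝓝 (β * γ)) := by
  have hkpos : ∀ᶠ m : ℕ in atTop, 0 < m ∧ 0 < k m := by
    filter_upwards [eventually_gt_atTop 0, hk.eventually_gt_atTop 0] with m hm hkm
    have : (0 : ℝ) < m := by exact_mod_cast hm
    exact ⟨hm, by rwa [div_pos_iff_of_pos_right this] at hkm⟩
  refine ae_tendsto_of_le (fun e he => ?_) fun e he => ?_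
  · have hlt : (q : EReal) < ν (γ + e / β) := by
      by_contra hcon
      have h1 := hγ.2 (show γ + e / β ∈ {x : ℝ | ν x ≤ (q : EReal)} from not_lt.1 hcon)
      have h2 : 0 < e / β := by positivity
      linarith
    obtain ⟨t, ht, htq⟩ := h.exists_of_lt_nu hν hlt
    filter_upwards [h.ae_eventually_R_lt ht htq] with ω hω
    filter_upwards [hω, hkpos] with m hm hkm
    refine (log_Y_le_of_lt hβ.le hkm.1 hkm.2 (floor_exp_pos hq m) hm).trans (le_of_eq ?_)
    field_simp
  · obtain ⟨x', hx', hae⟩ := h.ae_tailCount_ge hν hq (show ν γ ≤ (q : EReal) from hγ.1) le_rfl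
      (show 0 < e / (2 * β) by positivity)
    have hlim : Tendsto (fun m : ℕ => (q + e / (2 * β)) / (k m / m)) atTop (𝓝 0) :=
      hk.const_div_atTop _
    filter_upwards [hae] with ω hω
    filter_upwards [hω, hkpos, hlim.eventually (gt_mem_nhds (half_pos he))] with m hm hkm hs
    refine le_trans ?_ (le_log_Y hβ.le hkm.1 hkm.2 (floor_exp_pos hq m) hm)
    have h1 := mul_le_mul_of_nonneg_left hx' hβ.le
    have h2 : β * (e / (2 * β)) = e / 2 := by field_simp
    linarith

/-- The regime `k / m → α`. -/
theorem ae_tendsto_log_Y_of_tendsto_nhds (h : IsModel μ η lam χ)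
    (hν : ν = nu (cramer μ (η 0 0)) (legendre χ)) {β : ℝ} (hβ : 0 < β) (hq : 0 < q) {γ : ℝ}
    (hγ : IsGreatest {x : ℝ | ν x ≤ (q : EReal)} γ) {k : ℕ → ℝ} {α : ℝ} (hα : 1 ≤ α)
    (hk : Tendsto (fun m : ℕ => k m / (m : ℝ)) atTop (𝓝 α)) {L : ℝ}
    (hL : IsGLB ((fun x : ℝ => (ν x).toReal / α - β * x) '' {x : ℝ | ν x ≤ (q : EReal)}) L) :
    ∀ᵐ ω ∂μ, Tendsto (fun m : ℕ => Real.log (Y η lam β ⌊Real.exp (q * m)⌋₊ m (k m) ω))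
      atTop (𝓝 (-L)) := by
  have hα0 : 0 < α := by linarith
  have hkpos : ∀ᶠ m : ℕ in atTop, 0 < m ∧ 0 < k m := by
    filter_upwards [eventually_gt_atTop 0, hk.eventually (lt_mem_nhds hα0)] with m hm hkm
    have : (0 : ℝ) < m := by exact_mod_cast hm
    exact ⟨hm, by rwa [div_pos_iff_of_pos_right this] at hkm⟩
  -- Up to `γ` the rate is finite, so `toReal` never takes its default value at `⊤`.
  have hcoe : ∀ x, x ≤ γ → ν x ≤ (q : EReal) ∧ ((ν x).toReal : EReal) = ν x := fun x hx => by
    have h1 : ν x ≤ (q : EReal) := (h.nu_mono hν hx).trans hγ.1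
    exact ⟨h1, h.coe_toReal_nu hν (h1.trans_lt (EReal.coe_lt_top _))⟩
  have hγ0 : 0 ≤ γ := by
    refine hγ.2 ?_
    change ν 0 ≤ q
    rw [h.nu_of_nonpos hν le_rfl]
    exact_mod_cast hq.le
  have hLx : ∀ x, x ≤ γ → α * β * x - (ν x).toReal ≤ -(α * L) := fun x hx => by
    have h1 := hL.1 ⟨x, (hcoe x hx).1, rfl⟩
    have h2 := mul_le_mul_of_nonneg_left h1 hα0.le
    have h3 : α * ((ν x).toReal / α - β * x) = (ν x).toReal - α * β * x := by
      field_simp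
    simp only [h3] at h2
    linarith
  have hL0 : 0 ≤ -(α * L) := by
    have := hLx 0 hγ0
    rw [h.nu_of_nonpos hν le_rfl] at this
    simpa using this
  refine ae_tendsto_of_le (fun e he => ?_) fun e he => ?_
  · -- choice of the mesh
    have hcont : Tendsto (fun d : ℝ => (d * β * γ + (α + d) * β * d + d) / α) (𝓝[>] 0) (𝓝 0) := by
      have hc : Continuous fun d : ℝ => (d * β * γ + (α + d) * β * d + d) / α := by fun_prop
      have := hc.tendsto 0
      simp only [zero_mul, mul_zero, add_zero, zero_div] at this
      exact this.mono_left nhdsWithin_le_nhds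
    obtain ⟨d, hde, hd⟩ := ((hcont.eventually (gt_mem_nhds (half_pos he))).and
      self_mem_nhdsWithin).exists
    have hd0 : 0 < d := hd
    -- The three terms pay for replacing `α` by `k/m < α + d`, for using the right end of a cell,
    -- and for the slack `d` in the rate.
    set κ := d * β * γ + (α + d) * β * d + d with hκ
    have hκ0 : 0 < κ := by positivity
    -- `J d` is the first grid point beyond `γ`; there `ν > q`, so eventually no row reaches it.
    set J := ⌊γ / d⌋₊ + 1 with hJ
    have hJγ : γ < J * d := by
      rw [← div_lt_iff₀ hd0, hJ]
      push_cast
      exact Nat.lt_floor_add_one _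
    have hjγ : ∀ j < J, (j : ℝ) * d ≤ γ := fun j hj => by
      rw [← le_div_iff₀ hd0]
      exact (Nat.cast_le.2 (Nat.lt_succ_iff.1 hj)).trans (Nat.floor_le (by positivity))
    have hlt : (q : EReal) < ν (J * d) := by
      by_contra hcon
      exact absurd (hγ.2 (show (J : ℝ) * d ∈ {x : ℝ | ν x ≤ (q : EReal)} from not_lt.1 hcon))
        (not_le.2 hJγ)
    obtain ⟨t, ht, htq⟩ := h.exists_of_lt_nu hν hlt
    have hgrid : ∀ᵐ ω ∂μ, ∀ j : ℕ, j < J → ∀ᶠ m : ℕ in atTop,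
        tailCount η lam ⌊Real.exp (q * m)⌋₊ m (j * d) ω ≤
          ⌊Real.exp (q * m)⌋₊ * Real.exp (-(m * ((ν (j * d)).toReal - d))) := by
      refine ae_all_iff.2 fun j => ?_
      by_cases hj : j < J
      · have hlt : (((ν (j * d)).toReal - d : ℝ) : EReal) < ν (j * d) := by
          rw [← (hcoe _ (hjγ j hj)).2, EReal.coe_lt_coe_iff, EReal.toReal_coe]
          linarith
        obtain ⟨t, ht, htw⟩ := h.exists_of_lt_nu hν hlt
        filter_upwards [h.ae_eventually_tailCount_le (fun m : ℕ => ⌊Real.exp (q * m)⌋₊) ht htw]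
          with ω hω _ using hω
      · exact Eventually.of_forall fun ω hj' => absurd hj' hj
    have hlim1 : Tendsto (fun m : ℕ => (-(α * L) + κ) / (k m / m)) atTop
        (𝓝 ((-(α * L) + κ) / α)) := tendsto_const_nhds.div hk hα0.ne'
    have hktop : Tendsto k atTop atTop := by
      have h1 := hk.pos_mul_atTop hα0 (tendsto_natCast_atTop_atTop (R := ℝ))
      refine h1.congr' ?_
      filter_upwards [eventually_gt_atTop 0] with m hm
      have : (m : ℝ) ≠ 0 := by exact_mod_cast hm.ne'
      exact div_mul_cancel₀ _ this
    have hlim2 : Tendsto (fun m : ℕ => Real.log (1 + J) / k m) atTop (𝓝 0) :=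
      hktop.const_div_atTop _
    have hval : 0 + (-(α * L) + κ) / α < -L + e := by
      have e1 : (-(α * L) + κ) / α = -L + κ / α := by field_simp
      rw [e1]
      linarith
    filter_upwards [h.ae_eventually_R_lt ht htq, hgrid] with ω hω1 hω2
    have hω2' : ∀ᶠ m : ℕ in atTop, ∀ j < J, tailCount η lam ⌊Real.exp (q * m)⌋₊ m (j * d) ω ≤
        ⌊Real.exp (q * m)⌋₊ * Real.exp (-(m * ((ν (j * d)).toReal - d))) := by
      have := (eventually_all_finset (Finset.range J)).2
        fun j hj => hω2 j (Finset.mem_range.1 hj)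
      filter_upwards [this] with m hm j hj using hm j (Finset.mem_range.2 hj)
    filter_upwards [hω1, hω2', hkpos, (hlim2.add hlim1).eventually (gt_mem_nhds hval),
      hk.eventually (gt_mem_nhds (show α < α + d by linarith))] with m hm1 hm2 hkm hm3 hm4
    refine (log_Y_le_of_grid hβ.le hkm.1 hkm.2 (floor_exp_pos hq m) hd0
      (U := -(α * L) + κ) (by linarith) hm1 hm2 fun j hj => ?_).trans hm3.le
    have h1 := hLx _ (hjγ j hj)
    have h2 : β * ((j + 1) * d) * (k m / m) ≤ β * ((j + 1) * d) * (α + d) :=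
      mul_le_mul_of_nonneg_left hm4.le (by positivity)
    have h3 := mul_le_mul_of_nonneg_left (hjγ j hj) (show 0 ≤ d * β by positivity)
    linarith
  · obtain ⟨_, ⟨x, hx, rfl⟩, hxL⟩ := (isGLB_lt_iff hL).1 (show L < L + e / 4 by linarith)
    have hxγ : x ≤ γ := hγ.2 hx
    obtain ⟨hxq, hxc⟩ := hcoe x hxγ
    have hvq : (ν x).toReal ≤ q := by rw [← hxc] at hxq; exact_mod_cast hxq
    set d := e / (4 * (β + 1)) with hd
    have hd0 : 0 < d := by positivity
    have hdβ : (β + 1) * d = e / 4 := by rw [hd]; field_simp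
    obtain ⟨x', hx', hae⟩ := h.ae_tailCount_ge hν hq hxc.ge hvq hd0
    have hlim : Tendsto (fun m : ℕ => ((ν x).toReal + d) / (k m / m)) atTop
        (𝓝 (((ν x).toReal + d) / α)) := tendsto_const_nhds.div hk hα0.ne'
    filter_upwards [hae] with ω hω
    filter_upwards [hω, hkpos, hlim.eventually (gt_mem_nhds (show ((ν x).toReal + d) / α <
      ((ν x).toReal + d) / α + e / 4 by linarith))] with m hm hkm hs
    refine le_trans ?_ (le_log_Y hβ.le hkm.1 hkm.2 (floor_exp_pos hq m) hm)
    have h1 := mul_le_mul_of_nonneg_left hx' hβ.le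
    have h2 : ((ν x).toReal + d) / α ≤ (ν x).toReal / α + d := by
      rw [add_div]
      have : d / α ≤ d := div_le_self hd0.le hα
      linarith
    simp only at hxL
    linarith

end IsModel

end RandomProducts

/-! ### Assembly -/

theorem theorem4p1 {Ω : Type*} [MeasurableSpace Ω] (μ : Measure Ω) [IsProbabilityMeasure μ]
    (η : ℕ → ℕ → Ω → ℝ) (lam : ℕ → ℕ → Ω → ℕ) (χ : ℝ → ℝ) (β q : ℝ)
    -- the variables `η i j` are i.i.d., centred, with a finite exponential moment
    (hη_meas : ∀ i j, Measurable (η i j))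
    (hη_indep : iIndepFun (fun p : ℕ × ℕ => η p.1 p.2) μ)
    (hη_ident : ∀ i j, IdentDistrib (η i j) (η 0 0) μ μ)
    (hη_int : Integrable (η 0 0) μ)
    (hη_mean : ∫ ω, η 0 0 ω ∂μ = 0)
    (hη_exp : ∃ t : ℝ, 0 < t ∧ Integrable (fun ω => Real.exp (t * η 0 0 ω)) μ)
    -- the variables `lam i m` are independent, and their laws do not depend on `i`
    (hlam_meas : ∀ i m, Measurable (lam i m))
    (hlam_indep : iIndepFun (fun p : ℕ × ℕ => lam p.1 p.2) μ)
    (hlam_ident : ∀ i m, IdentDistrib (lam i m) (lam 0 m) μ μ)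
    (hlam_int : ∀ m, 1 ≤ m → Integrable (fun ω => (lam 0 m ω : ℝ)) μ)
    (hlam_mean : ∀ m, 1 ≤ m → ∫ ω, (lam 0 m ω : ℝ) ∂μ = m)
    -- the two families are independent of each other
    (hindep : IndepFun (fun ω (p : ℕ × ℕ) => η p.1 p.2 ω) (fun ω (p : ℕ × ℕ) => lam p.1 p.2 ω) μ)
    -- `E exp (t λ^{(m)}) = exp (m χ(t) (1 + o(1)))`, with `χ` smooth enough for large deviations
    (hχ : ∀ t : ℝ, 0 ≤ t → ∃ r : ℕ → ℝ, Tendsto r atTop (𝓝 0) ∧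
      ∀ᶠ m : ℕ in atTop, Integrable (fun ω => Real.exp (t * (lam 0 m ω : ℝ))) μ ∧
        ∫ ω, Real.exp (t * (lam 0 m ω : ℝ)) ∂μ = Real.exp ((m : ℝ) * χ t * (1 + r m)))
    (hχ_diff : ∀ t : ℝ, 0 < t → DifferentiableAt ℝ χ t)
    (hβ : 0 < β) (hq : 0 < q)
    (ν : ℝ → EReal)
    (hν : ν = RandomProducts.nu (RandomProducts.cramer μ (η 0 0)) (RandomProducts.legendre χ)) :
    -- the case `k / m → α ∈ [1, ∞)`
    (∀ (k : ℕ → ℝ) (α : ℝ), 1 ≤ α → Tendsto (fun m : ℕ => k m / (m : ℝ)) atTop (𝓝 α) →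
      ∃ L : ℝ,
        IsGLB ((fun x : ℝ => (ν x).toReal / α - β * x) '' {x : ℝ | ν x ≤ (q : EReal)}) L ∧
        ∀ᵐ ω ∂μ, Tendsto
          (fun m : ℕ => Real.log (RandomProducts.Y η lam β ⌊Real.exp (q * m)⌋₊ m (k m) ω))
          atTop (𝓝 (-L))) ∧
    -- the case `k ≫ m`; `γ` is `ν⁻¹(q)`
    (∃ γ : ℝ,
      IsLUB {x : ℝ | ν x ≤ (q : EReal)} γ ∧
      ((∃ x : ℝ, (q : EReal) ≤ ν x ∧ ν x < ⊤) → ∀ x : ℝ, ν x = (q : EReal) ↔ x = γ) ∧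
      IsGLB ((fun x : ℝ => -(β * x)) '' {x : ℝ | ν x ≤ (q : EReal)}) (-(β * γ)) ∧
      ∀ k : ℕ → ℝ, Tendsto (fun m : ℕ => k m / (m : ℝ)) atTop atTop →
        ∀ᵐ ω ∂μ, Tendsto
          (fun m : ℕ => Real.log (RandomProducts.Y η lam β ⌊Real.exp (q * m)⌋₊ m (k m) ω))
          atTop (𝓝 (β * γ))) := by
  have hχlim : ∀ t : ℝ, 0 ≤ t → Tendsto
      (fun m : ℕ => cgf (fun ω => (lam 0 m ω : ℝ)) μ t / m) atTop (𝓝 (χ t)) := by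
    intro t ht
    obtain ⟨r, hr, hm⟩ := hχ t ht
    have hlim : Tendsto (fun m : ℕ => χ t * (1 + r m)) atTop (𝓝 (χ t)) := by
      simpa using (hr.const_add 1).const_mul (χ t)
    refine hlim.congr' ?_
    filter_upwards [hm, eventually_gt_atTop 0] with m hm hm0
    have hm0' : (m : ℝ) ≠ 0 := by exact_mod_cast hm0.ne'
    rw [cgf, mgf, hm.2, Real.log_exp]
    field_simp
  have h : RandomProducts.IsModel μ η lam χ :=
    { meas_η := hη_meas
      indep_η := hη_indep
      ident_η := hη_ident
      int_η := hη_int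
      mean_η := hη_mean
      exp_η := hη_exp
      meas_lam := hlam_meas
      indep_lam := hlam_indep
      ident_lam := hlam_ident
      int_lam := hlam_int
      mean_lam := hlam_mean
      indep := hindep
      int_exp_lam := fun t ht => by
        obtain ⟨r, _, hm⟩ := hχ t ht
        exact hm.mono fun m hm => hm.1
      tendsto_cgf_lam := hχlim
      diff_χ := hχ_diff }
  have hγ := h.isGreatest_nu_le hν hq
  set γ := sSup {x : ℝ | ν x ≤ (q : EReal)}
  refine ⟨fun k α hα hk => ?_, γ, hγ.isLUB, fun hex => h.nu_eq_iff hν hq hγ hex, ?_,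
    fun k hk => h.ae_tendsto_log_Y_of_tendsto_atTop hν hβ hq hγ hk⟩
  · have hα0 : 0 < α := by linarith
    set S := (fun x : ℝ => (ν x).toReal / α - β * x) '' {x : ℝ | ν x ≤ (q : EReal)}
    have hS : IsGLB S (sInf S) := by
      refine isGLB_csInf ⟨_, γ, hγ.1, rfl⟩ ⟨-(β * γ), ?_⟩
      rintro _ ⟨x, hx, rfl⟩
      have h1 := mul_le_mul_of_nonneg_left (hγ.2 hx) hβ.le
      have h2 := div_nonneg (h.toReal_nu_nonneg hν x) hα0.le
      simp only
      linarith
    exact ⟨sInf S, hS, h.ae_tendsto_log_Y_of_tendsto_nhds hν hβ hq hγ hα hk hS⟩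
  · refine IsLeast.isGLB ⟨⟨γ, hγ.1, rfl⟩, ?_⟩
    rintro _ ⟨x, hx, rfl⟩
    exact neg_le_neg (mul_le_mul_of_nonneg_left (hγ.2 hx) hβ.le)
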